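/- **Theorem 3.2.** Let $G$ be a finite simple plane graph with an even number of vertices, each edge $e$ carrying a weight $\omega_e$ in a commutative ring (for instance a real number or an indeterminate). For a subgraph $H$ of $G$ let $M(H)$ denote the sum, over all perfect matchings of $H$, of the product of the weights of the edges of the matching. Let $k\ge 2$ and let $e_1=a_1b_1,\dots,e_k=a_kb_k$ be $k$ independent edges (no two share an endpoint) in the boundary of a face $f$ of $G$, such that the vertices $a_1,b_1,a_2,b_2,\dots,a_k,b_k$ appear in this cyclic order on $f$. Put $B=\{b_1,\dots,b_k\}$, $[k]=\{1,\dots,k\}$, and for $I\subseteq[k]$ put $\overline I=[k]\setminus I$, $E_I=\{e_i: i\in I\}$, $A_I=\{a_i: i\in I\}$, $B_I=\{b_i: i\in I\}$; for $W\subseteq B$ put $I_W=\{i: b_i\in W\}$. Deleting a vertex also deletes the edges incident with it. Then for every $j\in[k]$ $$\sum_{\substack{W\subseteq B\\ |W|\text{ even}}}\Big(\prod_{e\in E_{I_W}}\omega_e\Big)\,M(G-A_{I_W})\,M(G-E_{\overline{I_W}}-B_{I_W})$$ $$=\sum_{\substack{Y\subseteq B\\ |Y|\text{ odd}}}\Big(\prod_{e\in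 E_{\{j\}\triangle I_Y}}\omega_e\Big)\,M\big(G-E_{I_Y\cap\{j\}}-B_{\{j\}\setminus I_Y}-A_{I_Y\setminus\{j\}}\big)\,M\big(G-E_{\overline{I_Y}\cap\overline{\{j\}}}-B_{\overline{\{j\}}\setminus\overline{I_Y}}-A_{\overline{I_Y}\setminus\overline{\{j\}}}\big).$$ -/

import Mathlib

universe u v

/-- A rotation system: at every vertex, the cyclic (counterclockwise) order in which the edges leave
that vertex, encoded as a permutation of the darts (oriented edges) whose cycles are exactly the sets
of darts with a common initial vertex. -/
structure RotationSystem {V : Type u} (G : SimpleGraph V) where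
  rot : Equiv.Perm G.Dart
  rot_fst : ∀ d, (rot d).fst = d.fst
  rot_sameCycle : ∀ d d' : G.Dart, d.fst = d'.fst → rot.SameCycle d d'

namespace RotationSystem

variable {V : Type u} {G : SimpleGraph V} (R : RotationSystem G)

/-- Face tracing: the dart that follows `d` on the boundary walk of the face lying beside `d`.
It starts at the vertex where `d` ends. -/
def next : Equiv.Perm G.Dart :=
  (Function.Involutive.toPerm SimpleGraph.Dart.symm SimpleGraph.Dart.symm_involutive).trans R.rot

/-- The facial walks: the cyclic sequences of darts produced by face tracing. -/
def FacialWalk : Type u :=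
  Quotient (Equiv.Perm.SameCycle.setoid R.next)

/-- The facial walk on which a dart lies. -/
def walkOf (d : G.Dart) : R.FacialWalk :=
  Quotient.mk (Equiv.Perm.SameCycle.setoid R.next) d

/-- The connected pieces of the boundaries of faces: a facial walk, or an isolated vertex. -/
def BoundaryPiece : Type u :=
  R.FacialWalk ⊕ {v : V // ∀ u, ¬ G.Adj v u}

theorem component_next (d : G.Dart) :
    G.connectedComponentMk (R.next d).fst = G.connectedComponentMk d.fst := by
  have h : (R.next d).fst = d.snd := R.rot_fst d.symm
  rw [h]
  exact SimpleGraph.ConnectedComponent.sound d.adj.symm.reachable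

theorem component_sameCycle (d d' : G.Dart) (h : R.next.SameCycle d d') :
    G.connectedComponentMk d.fst = G.connectedComponentMk d'.fst := by
  obtain ⟨n, rfl⟩ := h
  induction n using Int.induction_on with
  | zero => rfl
  | succ n ih => rw [ih, add_comm, zpow_add, zpow_one, Equiv.Perm.mul_apply, component_next]
  | pred n ih =>
    rw [ih, ← R.component_next ((R.next ^ (-(n : ℤ) - 1)) d), ← Equiv.Perm.mul_apply]
    congr 3
    rw [← zpow_one_add]
    congr 2
    ring

/-- The connected component of the graph to which a boundary piece belongs. -/
def componentOf : R.BoundaryPiece → G.ConnectedComponent :=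
  Sum.elim
    (Quotient.lift (fun d : G.Dart => G.connectedComponentMk d.fst) R.component_sameCycle)
    (fun v => G.connectedComponentMk v.1)

end RotationSystem

/-- A plane graph (a drawing of the finite graph `G` on the sphere, up to homeomorphism), as a
combinatorial map. The graph need not be connected.

* `euler`: the rotation system has genus zero on every connected component, i.e. `V - E + F = 2` for
  each component drawn separately. (It is summed over the components; no component can have
  `V - E + F > 2`.)
* `Face`, `face`: the faces of the whole drawing, and the face that a boundary piece bounds. If `G` is
  connected there is one face for each facial walk. In general a face is a sphere with holes, with one
  boundary piece for each hole, and these pieces belong to different components (`face_inj`); the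
  drawing being on one sphere, the incidence graph between components and faces is a tree (`tree`).
-/
structure PlaneEmbedding {V : Type u} (G : SimpleGraph V) extends RotationSystem G where
  euler : Nat.card V + Nat.card toRotationSystem.BoundaryPiece
    = Nat.card G.edgeSet + 2 * Nat.card G.ConnectedComponent
  Face : Type v
  face : toRotationSystem.BoundaryPiece → Face
  face_inj : ∀ p q, toRotationSystem.componentOf p = toRotationSystem.componentOf q →
    face p = face q → p = q
  tree : (SimpleGraph.fromRel (fun x y : G.ConnectedComponent ⊕ Face =>
    ∃ p, x = Sum.inl (toRotationSystem.componentOf p) ∧ y = Sum.inr (face p))).IsTree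

namespace PlaneEmbedding

variable {V : Type u} {G : SimpleGraph V} (P : PlaneEmbedding.{u, v} G)

/-- The face lying beside a dart. -/
def faceOf (d : G.Dart) : P.Face := P.face (Sum.inl (P.walkOf d))

/-- The edge `e` lies in the boundary of the face `f`. -/
def OnBoundary (f : P.Face) (e : Sym2 V) : Prop :=
  ∃ d : G.Dart, d.edge = e ∧ P.faceOf d = f

/-- The vertices `x t` occur on the boundary of the face `f` in this order, for the direction in which
face tracing runs. Every `x t` is assigned an occurrence on the boundary, marked by the dart `c t`
with which the walk leaves `x t` there. The vertices lying on one facial walk are met in the order of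
their indices during one turn along the walk (from a suitable starting point `d`). If the boundary of
`f` consists of several walks, then in addition the groups of vertices on different walks do not cross
in the cyclic order of the indices. -/
def OrderedOn (f : P.Face) {ι : Type*} [LinearOrder ι] (x : ι → V) : Prop :=
  ∃ c : ι → G.Dart,
    (∀ t, (c t).fst = x t) ∧
    (∀ t, P.faceOf (c t) = f) ∧
    (∀ ω : P.FacialWalk, ∃ (d : G.Dart) (pos : ι → ℕ),
      StrictMonoOn pos {t | P.walkOf (c t) = ω} ∧
      ∀ t, P.walkOf (c t) = ω →
        pos t < Function.minimalPeriod P.next d ∧ (P.next)^[pos t] d = c t) ∧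
    (∀ s t s' t' : ι, s < t → t < s' → s' < t' →
      P.walkOf (c s) = P.walkOf (c s') → P.walkOf (c t) = P.walkOf (c t') →
      P.walkOf (c s) = P.walkOf (c t))

/-- The vertices `x t` appear in this cyclic order on the face `f`, clockwise or counterclockwise. -/
def InCyclicOrder (f : P.Face) {ι : Type*} [LinearOrder ι] (x : ι → V) : Prop :=
  P.OrderedOn f x ∨ P.OrderedOn f (fun t : ιᵒᵈ => x (OrderDual.ofDual t))

end PlaneEmbedding

/-- `M(H)`: the sum of the weights of the perfect matchings of `H`, a subgraph of `G` with edge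
weights `w`. The weight of a perfect matching is the product of the weights of its edges. -/
noncomputable def matchingSum {V : Type*} {R : Type*} [CommRing R] {G : SimpleGraph V}
    (w : Sym2 V → R) (H : G.Subgraph) : R :=
  ∑ᶠ N ∈ {N : G.Subgraph | N ≤ H ∧ N.verts = H.verts ∧ N.IsMatching}, ∏ᶠ e ∈ N.edgeSet, w e

/-- `G - E - S`: delete the edges in `E` and the vertices in `S` (with their incident edges). -/
def graphMinus {V : Type*} (G : SimpleGraph V) (E : Finset (Sym2 V)) (S : Finset V) : G.Subgraph :=
  ((⊤ : G.Subgraph).deleteEdges E).deleteVerts S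

/-- `I_W = {i | b_i ∈ W}`. -/
def indexSet {V : Type*} [DecidableEq V] {k : ℕ} (b : Fin k → V) (W : Finset V) : Finset (Fin k) :=
  Finset.univ.filter (fun i => b i ∈ W)

/-- `E_I = {a_i b_i | i ∈ I}`. -/
def edgesAt {V : Type*} [DecidableEq V] {k : ℕ} (a b : Fin k → V) (I : Finset (Fin k)) :
    Finset (Sym2 V) :=
  I.image (fun i => s(a i, b i))

/-- `A_I = {a_i | i ∈ I}` (and likewise `B_I`). -/
def vertsAt {V : Type*} [DecidableEq V] {k : ℕ} (a : Fin k → V) (I : Finset (Fin k)) : Finset V :=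
  I.image a

/-- The sequence `a_1, b_1, a_2, b_2, …, a_k, b_k`. -/
def interleave {V : Type*} {k : ℕ} (a b : Fin k → V) : Fin k ×ₗ Fin 2 → V :=
  fun t => ![a (ofLex t).1, b (ofLex t).1] (ofLex t).2

/-! Call the e_i marked, let G₀ be G without them, and let Z(S) be the weighted count of matchings
of G₀ covering exactly the vertices outside S. Since G has evenly many vertices, terms with W or Y
of the wrong parity contain a zero factor, so the parity restrictions can be dropped. Sorting
matchings by the marked edges they use (`matchingPoly_union_edgesAt`) turns both sides into sums,
over sets T of indices, of the weight of E_T times products of two values of Z. For j ∉ T the two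
sides agree term by term. For j ∈ T what remains is Σ_{K⊆T} Z(A_T ∪ B_{T∖K}) Z(B_K) = Σ_{K⊆T}
Z(A_{T∖j} ∪ B_{T∖K}) Z({a_j} ∪ B_K), which is `sum_matchingPoly_swap`.

To prove it, superpose the two matchings M, N of a product. Degrees are 1 on A_T ∪ B_T and 2
elsewhere, so the component of a_j is a path. Exchanging M and N on it preserves the weight, moves
a_j from the vertices missed by M to those missed by N, and is undone by the same exchange; the
summation over K absorbs what happens at the b_i. The only obstacle would be a path ending at
another a_l. In that case a parity count off the path (`not_reachable_of_incCount`) yields a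
disjoint walk from b_j to b_l, against the cyclic order a_j, b_j, a_l, b_l on f.

That two such walks must meet (`exists_mem_support_of_crossing`) is a combinatorial Jordan curve
argument: in genus zero the facial walks span the cycle space modulo two (`exists_potential`), so a
closed curve has two sides. -/

namespace SimpleGraph

/-! ### Chains of edges modulo two. -/

variable {V : Type*} {G : SimpleGraph V}

theorem Reachable.eq_of_isolated {v w : V} (h : G.Reachable v w) (hv : ∀ u, ¬ G.Adj v u) :
    v = w := by
  obtain ⟨p⟩ := h
  cases p with
  | nil => rfl
  | cons h _ => exact (hv _ h).elim

/-- A dart on each edge, i.e. an arbitrary orientation of the graph. -/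
noncomputable def edgeDart (e : G.edgeSet) : G.Dart :=
  (Sym2.inductionOn (f := fun e => e ∈ G.edgeSet → ∃ d : G.Dart, d.edge = e) e.1
    (fun u v h => ⟨⟨(u, v), h⟩, rfl⟩) e.2).choose

theorem edgeDart_edge (e : G.edgeSet) : (edgeDart e).edge = e.1 :=
  (Sym2.inductionOn (f := fun e => e ∈ G.edgeSet → ∃ d : G.Dart, d.edge = e) e.1
    (fun u v h => ⟨⟨(u, v), h⟩, rfl⟩) e.2).choose_spec

theorem edgeDart_eq_or (d : G.Dart) :
    edgeDart ⟨d.edge, d.edge_mem⟩ = d ∨ edgeDart ⟨d.edge, d.edge_mem⟩ = d.symm :=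
  (dart_edge_eq_iff _ _).1 (edgeDart_edge ⟨d.edge, d.edge_mem⟩)

/-- The sum modulo two of the values of a function at the two darts of each edge. -/
noncomputable def dartToEdge (G : SimpleGraph V) :
    (G.Dart → ZMod 2) →ₗ[ZMod 2] (G.edgeSet → ZMod 2) :=
  LinearMap.funLeft _ _ edgeDart + LinearMap.funLeft _ _ (fun e => (edgeDart e).symm)

theorem dartToEdge_edge (z : G.Dart → ZMod 2) (d : G.Dart) :
    dartToEdge G z ⟨d.edge, d.edge_mem⟩ = z d + z d.symm := by
  rcases edgeDart_eq_or d with h | h <;>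
    simp [dartToEdge, LinearMap.funLeft_apply, h, add_comm]

theorem sum_dart_eq_sum_edgeSet [Fintype G.Dart] [Fintype G.edgeSet] {M : Type*} [AddCommMonoid M]
    (g : G.Dart → M) :
    ∑ d, g d = ∑ e : G.edgeSet, (g (edgeDart e) + g (edgeDart e).symm) := by
  classical
  rw [← Finset.sum_fiberwise (s := Finset.univ)
    (g := fun d : G.Dart => (⟨d.edge, d.edge_mem⟩ : G.edgeSet))]
  refine Finset.sum_congr rfl fun e _ => ?_
  have : (Finset.univ.filter fun d : G.Dart => (⟨d.edge, d.edge_mem⟩ : G.edgeSet) = e)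
      = {edgeDart e, (edgeDart e).symm} := by
    ext d
    simp only [Finset.mem_filter, Finset.mem_univ, true_and, Finset.mem_insert,
      Finset.mem_singleton, Subtype.ext_iff, ← edgeDart_edge e]
    exact dart_edge_eq_iff _ _
  rw [this, Finset.sum_pair (Dart.symm_ne _).symm]

open Classical in
/-- The boundary of a chain of edges modulo two. -/
noncomputable def edgeBoundary (G : SimpleGraph V) [Fintype G.edgeSet] :
    (G.edgeSet → ZMod 2) →ₗ[ZMod 2] (V → ZMod 2) :=
  Fintype.linearCombination (ZMod 2) fun e : G.edgeSet =>
    (Pi.single (edgeDart e).fst 1 + Pi.single (edgeDart e).snd 1 : V → ZMod 2)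

open Classical in
theorem edgeBoundary_dartToEdge [Fintype G.edgeSet] [Fintype G.Dart] (z : G.Dart → ZMod 2) :
    edgeBoundary G (dartToEdge G z)
      = ∑ d, z d • (Pi.single d.fst 1 + Pi.single d.snd 1 : V → ZMod 2) := by
  rw [sum_dart_eq_sum_edgeSet, edgeBoundary, Fintype.linearCombination_apply]
  refine Finset.sum_congr rfl fun e _ => ?_
  simp only [dartToEdge, LinearMap.add_apply, Pi.add_apply, LinearMap.funLeft_apply, add_smul]
  congr 2
  exact add_comm _ _

/-- Modulo boundaries of edges each vertex equals a chosen vertex of its component, so boundaries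
and chosen vertices together span all vertex chains. -/
theorem card_le_finrank_range_edgeBoundary [Fintype V] [Fintype G.edgeSet] :
    Nat.card V ≤ Module.finrank (ZMod 2) (LinearMap.range (edgeBoundary G))
      + Nat.card G.ConnectedComponent := by
  classical
  have : Fintype G.ConnectedComponent := Fintype.ofFinite _
  let γ : (G.ConnectedComponent → ZMod 2) →ₗ[ZMod 2] (V → ZMod 2) :=
    Fintype.linearCombination (ZMod 2) fun c => (Pi.single c.out 1 : V → ZMod 2)
  have hγ : ∀ c : G.ConnectedComponent, (Pi.single c.out 1 : V → ZMod 2) ∈ LinearMap.range γ := by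
    intro c
    refine ⟨Pi.single c 1, ?_⟩
    simp [γ]
  have hadj : ∀ u v, G.Adj u v → (Pi.single u 1 + Pi.single v 1 : V → ZMod 2) ∈
      LinearMap.range (edgeBoundary G) := by
    intro u v h
    let d : G.Dart := ⟨(u, v), h⟩
    refine ⟨Pi.single ⟨d.edge, d.edge_mem⟩ 1, ?_⟩
    rw [edgeBoundary, Fintype.linearCombination_apply_single, one_smul]
    rcases edgeDart_eq_or d with h | h <;> rw [h]
    exact add_comm _ _
  have htwo : ∀ x : V → ZMod 2, x + x = 0 := fun x => by
    ext v; exact CharTwo.add_self_eq_zero _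
  have key : ∀ u v, G.Reachable u v →
      (Pi.single u 1 + Pi.single v 1 : V → ZMod 2) ∈ LinearMap.range (edgeBoundary G) := by
    rintro u v ⟨p⟩
    induction p with
    | nil => rw [htwo]; exact zero_mem _
    | @cons u v w h p ih =>
      have := add_mem (hadj _ _ h) ih
      rwa [add_assoc, ← add_assoc (Pi.single v 1), htwo, zero_add] at this
  have htop : LinearMap.range (edgeBoundary G) ⊔ LinearMap.range γ = ⊤ := by
    rw [eq_top_iff]
    intro x _
    rw [← Finset.univ_sum_single x]
    refine sum_mem fun v _ => ?_
    have h1 : (Pi.single v 1 : V → ZMod 2) ∈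
        LinearMap.range (edgeBoundary G) ⊔ LinearMap.range γ := by
      have hr : G.Reachable v (G.connectedComponentMk v).out :=
        (ConnectedComponent.exact (Quot.out_eq (G.connectedComponentMk v))).symm
      have := Submodule.add_mem_sup (key _ _ hr) (hγ (G.connectedComponentMk v))
      rwa [add_assoc, htwo, add_zero] at this
    have := Submodule.smul_mem _ (x v) h1
    rwa [← Pi.single_smul, smul_eq_mul, mul_one] at this
  have h := Submodule.finrank_add_le_finrank_add_finrank
    (LinearMap.range (edgeBoundary G)) (LinearMap.range γ)
  rw [htop, finrank_top, Module.finrank_fintype_fun_eq_card] at h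
  have h2 := LinearMap.finrank_range_le γ
  rw [Module.finrank_fintype_fun_eq_card] at h2
  rw [Nat.card_eq_fintype_card, Nat.card_eq_fintype_card]
  omega

end SimpleGraph

/-! ### Facial walks and the cycle space in genus zero. -/

namespace RotationSystem

open SimpleGraph

variable {V : Type u} {G : SimpleGraph V} (R : RotationSystem G)

theorem walkOf_next (d : G.Dart) : R.walkOf (R.next d) = R.walkOf d :=
  Quotient.sound (s := Equiv.Perm.SameCycle.setoid R.next)
    (Equiv.Perm.sameCycle_apply_left.2 (Equiv.Perm.SameCycle.refl _ _))

theorem next_fst (d : G.Dart) : (R.next d).fst = d.snd :=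
  R.rot_fst d.symm

theorem next_symm (d : G.Dart) : R.next d.symm = R.rot d := by
  simp [next]

/-- A function on the darts that is preserved by rotation about a vertex is constant there. -/
theorem eq_of_rot_eq [Finite V] {α : Type*} {v : V} (g : G.Dart → α)
    (h : ∀ d, d.fst = v → g (R.rot d) = g d)
    {d d' : G.Dart} (hd : d.fst = v) (hd' : d'.fst = v) : g d = g d' := by
  classical
  have : Finite G.Dart := Finite.of_injective (fun d : G.Dart => d.toProd) Dart.toProd_injective
  obtain ⟨n, -, -, rfl⟩ := (R.rot_sameCycle d d' (hd.trans hd'.symm)).exists_pow_eq''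
  have key : ∀ n : ℕ, ((R.rot ^ n) d).fst = v ∧ g ((R.rot ^ n) d) = g d := by
    intro n
    induction n with
    | zero => exact ⟨hd, rfl⟩
    | succ n ih =>
      rw [pow_succ', Equiv.Perm.mul_apply]
      exact ⟨(R.rot_fst _).trans ih.1, (h _ ih.1).trans ih.2⟩
  exact (key n).2.symm

/-- Isolated vertices correspond to the components without darts. -/
theorem card_boundaryPiece [Finite V] :
    Nat.card R.BoundaryPiece + Nat.card {c : G.ConnectedComponent //
        ∃ d : G.Dart, G.connectedComponentMk d.fst = c}
      = Nat.card R.FacialWalk + Nat.card G.ConnectedComponent := by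
  classical
  have : Finite G.Dart := Finite.of_injective (fun d : G.Dart => d.toProd) Dart.toProd_injective
  have : Finite R.FacialWalk := Quotient.finite _
  rw [BoundaryPiece, Nat.card_sum, ← Nat.card_congr (Equiv.sumCompl
    (fun c : G.ConnectedComponent => ∃ d : G.Dart, G.connectedComponentMk d.fst = c)),
    Nat.card_sum]
  have : Nat.card {v : V // ∀ u, ¬ G.Adj v u} = Nat.card {c : G.ConnectedComponent //
      ¬ ∃ d : G.Dart, G.connectedComponentMk d.fst = c} := by
    refine Nat.card_congr (Equiv.ofBijective (fun v => ⟨G.connectedComponentMk v.1, ?_⟩) ⟨?_, ?_⟩)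
    · rintro ⟨d, hd⟩
      have h := (ConnectedComponent.exact hd).symm.eq_of_isolated v.2
      exact v.2 d.snd (h ▸ d.adj)
    · intro v w h
      exact Subtype.ext
        ((ConnectedComponent.exact (congrArg Subtype.val h)).eq_of_isolated v.2)
    · rintro ⟨c, hc⟩
      induction c using ConnectedComponent.ind with
      | h v => exact ⟨⟨v, fun u hu => hc ⟨⟨(v, u), hu⟩, rfl⟩⟩, rfl⟩
  omega

/-- The boundary, modulo two, of a chain of facial walks. -/
noncomputable def walkBoundary : (R.FacialWalk → ZMod 2) →ₗ[ZMod 2] (G.edgeSet → ZMod 2) :=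
  dartToEdge G ∘ₗ LinearMap.funLeft _ _ R.walkOf

theorem walkBoundary_edge (φ : R.FacialWalk → ZMod 2) (d : G.Dart) :
    R.walkBoundary φ ⟨d.edge, d.edge_mem⟩ = φ (R.walkOf d) + φ (R.walkOf d.symm) :=
  dartToEdge_edge _ d

/-- A chain without boundary has equal values on the two sides of every edge, hence around every
vertex and throughout a component; one value per component with a dart determines it. -/
theorem finrank_ker_walkBoundary_le [Fintype V] :
    Module.finrank (ZMod 2) (LinearMap.ker R.walkBoundary)
      ≤ Nat.card {c : G.ConnectedComponent // ∃ d : G.Dart, G.connectedComponentMk d.fst = c} := by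
  classical
  have : Finite G.Dart := Finite.of_injective (fun d : G.Dart => d.toProd) Dart.toProd_injective
  have : Finite R.FacialWalk := Quotient.finite _
  have : Fintype {c : G.ConnectedComponent // ∃ d : G.Dart, G.connectedComponentMk d.fst = c} :=
    Fintype.ofFinite _
  let ρ : (R.FacialWalk → ZMod 2) →ₗ[ZMod 2]
      ({c : G.ConnectedComponent // ∃ d : G.Dart, G.connectedComponentMk d.fst = c} → ZMod 2) :=
    LinearMap.funLeft _ _ (fun c => R.walkOf c.2.choose)
  have hinj : Function.Injective (ρ.domRestrict (LinearMap.ker R.walkBoundary)) := by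
    rw [← LinearMap.ker_eq_bot, LinearMap.ker_eq_bot']
    rintro ⟨φ, hφ⟩ h0
    have hsymm : ∀ d : G.Dart, φ (R.walkOf d.symm) = φ (R.walkOf d) := by
      intro d
      have h := R.walkBoundary_edge φ d
      rw [LinearMap.mem_ker.1 hφ, Pi.zero_apply] at h
      exact ((CharTwo.add_eq_zero).1 h.symm).symm
    have hrot : ∀ d : G.Dart, φ (R.walkOf (R.rot d)) = φ (R.walkOf d) := by
      intro d
      rw [← R.next_symm, walkOf_next, hsymm]
    have hreach : ∀ u v, G.Reachable u v → ∀ d d' : G.Dart, d.fst = u → d'.fst = v →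
        φ (R.walkOf d) = φ (R.walkOf d') := by
      rintro u v ⟨p⟩
      induction p with
      | nil =>
        intro d d' hd hd'
        exact R.eq_of_rot_eq (fun d => φ (R.walkOf d)) (fun d _ => hrot d) hd hd'
      | @cons u v w h p ih =>
        intro d d' hd hd'
        let x : G.Dart := ⟨(u, v), h⟩
        have h1 : φ (R.walkOf d) = φ (R.walkOf x) :=
          R.eq_of_rot_eq (fun d => φ (R.walkOf d)) (fun d _ => hrot d) hd rfl
        rw [h1, ← hsymm]
        exact ih _ _ rfl hd'
    refine Subtype.ext (funext fun ω => ?_)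
    induction ω using Quotient.inductionOn with
    | h d =>
      let c : {c : G.ConnectedComponent // ∃ d : G.Dart, G.connectedComponentMk d.fst = c} :=
        ⟨G.connectedComponentMk d.fst, d, rfl⟩
      have h1 : φ (R.walkOf c.2.choose) = 0 := congrFun h0 c
      have h2 := ConnectedComponent.exact c.2.choose_spec
      have h3 : φ (R.walkOf d) = 0 := by
        rw [← h1]
        exact hreach _ _ h2.symm _ _ rfl rfl
      exact h3
  have := LinearMap.finrank_le_finrank_of_injective hinj
  rwa [Module.finrank_fintype_fun_eq_card, ← Nat.card_eq_fintype_card] at this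

/-- In genus zero every cycle modulo two is the boundary of a chain of faces. -/
theorem exists_potential [Fintype V] [Fintype G.Dart]
    (euler : Nat.card V + Nat.card R.BoundaryPiece
      = Nat.card G.edgeSet + 2 * Nat.card G.ConnectedComponent)
    (z : G.Dart → ZMod 2) (hz : ∀ h : V → ZMod 2, ∑ d, z d * (h d.fst + h d.snd) = 0) :
    ∃ φ : R.FacialWalk → ZMod 2,
      ∀ d, φ (R.walkOf d) + φ (R.walkOf d.symm) = z d + z d.symm := by
  classical
  have : Fintype R.FacialWalk := @Fintype.ofFinite _ (Quotient.finite _)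
  have : Fintype G.edgeSet := Fintype.ofFinite _
  have hcyc : ∀ z : G.Dart → ZMod 2, (∀ h : V → ZMod 2, ∑ d, z d * (h d.fst + h d.snd) = 0) →
      dartToEdge G z ∈ LinearMap.ker (edgeBoundary G) := by
    intro z hz
    rw [LinearMap.mem_ker, edgeBoundary_dartToEdge]
    ext v
    have := hz (Pi.single v 1)
    rw [Finset.sum_apply]
    simpa [Pi.single_apply, eq_comm] using this
  have hle : LinearMap.range R.walkBoundary ≤ LinearMap.ker (edgeBoundary G) := by
    rintro _ ⟨φ, rfl⟩
    refine hcyc _ fun h => ?_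
    simp only [LinearMap.funLeft_apply, mul_add, Finset.sum_add_distrib]
    -- Facial walks are closed: shifting by `next` turns the sum over initial vertices into the sum
    -- over end vertices.
    rw [← Equiv.sum_comp R.next fun d => φ (R.walkOf d) * h d.fst]
    simp only [walkOf_next, next_fst]
    exact CharTwo.add_self_eq_zero _
  have heq : LinearMap.range R.walkBoundary = LinearMap.ker (edgeBoundary G) := by
    -- The rank is at least the number of facial walks minus that of components with darts, the
    -- cycle space has dimension at most E − V + c (c components), and the Euler relation equates
    -- these two bounds.
    refine Submodule.eq_of_le_of_finrank_le hle ?_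
    have h1 := LinearMap.finrank_range_add_finrank_ker R.walkBoundary
    have h2 := LinearMap.finrank_range_add_finrank_ker (edgeBoundary G)
    have h3 := R.finrank_ker_walkBoundary_le
    have h4 := card_le_finrank_range_edgeBoundary (G := G)
    have h5 := R.card_boundaryPiece
    rw [Module.finrank_fintype_fun_eq_card, ← Nat.card_eq_fintype_card] at h1 h2
    omega
  obtain ⟨φ, hφ⟩ : dartToEdge G z ∈ LinearMap.range R.walkBoundary := heq ▸ hcyc z hz
  refine ⟨φ, fun d => ?_⟩
  rw [← walkBoundary_edge, hφ, dartToEdge_edge]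

end RotationSystem

/-! ### Crossing paths on a face. -/

namespace SimpleGraph

variable {V : Type*} {G : SimpleGraph V}

/-- The sum telescopes: tested against any `h`, the boundary of a walk is its two ends. -/
theorem Walk.sum_count_darts [DecidableEq V] [Fintype G.Dart] {u v : V} (p : G.Walk u v)
    (h : V → ZMod 2) :
    ∑ d, (p.darts.count d : ZMod 2) * (h d.fst + h d.snd) = h u + h v := by
  induction p with
  | nil => simp [CharTwo.add_self_eq_zero]
  | @cons u v w a p ih =>
    simp only [Walk.darts_cons, List.count_cons, Nat.cast_add, add_mul, Finset.sum_add_distrib, ih]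
    simp only [beq_iff_eq, Nat.cast_ite, Nat.cast_one, Nat.cast_zero, ite_mul, one_mul, zero_mul,
      Finset.sum_ite_eq, Finset.mem_univ, if_true]
    rw [add_comm, add_assoc, ← add_assoc (h v) (h v), CharTwo.add_self_eq_zero, zero_add]

theorem Walk.count_darts_eq_zero [DecidableEq V] {u v : V} (p : G.Walk u v) {d : G.Dart}
    (hd : d.fst ∉ p.support) : p.darts.count d = 0 ∧ p.darts.count d.symm = 0 :=
  ⟨List.count_eq_zero.2 fun h => hd (p.dart_fst_mem_support_of_mem_darts h),
    List.count_eq_zero.2 fun h => hd (p.dart_snd_mem_support_of_mem_darts h)⟩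

end SimpleGraph

namespace RotationSystem

open SimpleGraph

variable {V : Type u} {G : SimpleGraph V} (R : RotationSystem G)

theorem iterate_succ_fst (d : G.Dart) (n : ℕ) :
    ((R.next)^[n + 1] d).fst = ((R.next)^[n] d).snd := by
  rw [Function.iterate_succ_apply', next_fst]

theorem walkOf_iterate (d : G.Dart) (n : ℕ) : R.walkOf ((R.next)^[n] d) = R.walkOf d := by
  induction n with
  | zero => rfl
  | succ n ih => rw [Function.iterate_succ_apply', walkOf_next, ih]

theorem sum_segment (d : G.Dart) (h : V → ZMod 2) {s u : ℕ} (hsu : s ≤ u) :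
    ∑ i ∈ Finset.Ico s u, (h ((R.next)^[i] d).fst + h ((R.next)^[i] d).snd)
      = h ((R.next)^[s] d).fst + h ((R.next)^[u] d).fst := by
  induction u, hsu using Nat.le_induction with
  | base => simp [CharTwo.add_self_eq_zero]
  | succ u hu ih =>
    rw [Finset.sum_Ico_succ_top hu, ih, iterate_succ_fst, add_assoc,
      ← add_assoc (h _) (h _) (h _), CharTwo.add_self_eq_zero, zero_add]

/-- Disjoint paths in a plane graph do not join crossing pairs of corners of a facial walk. -/
theorem exists_mem_support_of_crossing [Fintype V]
    (euler : Nat.card V + Nat.card R.BoundaryPiece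
      = Nat.card G.edgeSet + 2 * Nat.card G.ConnectedComponent)
    (d : G.Dart) {s t u v : ℕ} (hst : s < t) (htu : t < u) (huv : u < v)
    (hv : v < Function.minimalPeriod R.next d) {x y : V} (p : G.Walk x y)
    (hx : ((R.next)^[s] d).fst = x) (hy : ((R.next)^[u] d).fst = y)
    {x' y' : V} (q : G.Walk x' y') (hx' : ((R.next)^[t] d).fst = x')
    (hy' : ((R.next)^[v] d).fst = y') : ∃ z ∈ q.support, z ∈ p.support := by
  by_contra! hdisj
  classical
  have : Fintype G.Dart := @Fintype.ofFinite _
    (Finite.of_injective (fun d : G.Dart => d.toProd) Dart.toProd_injective)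
  have hinj := Function.iterate_injOn_Iio_minimalPeriod (f := R.next) (x := d)
  -- The facial walk from step `s` to step `u` and the walk `p` have the same ends, so together they
  -- form a cycle modulo two.
  let S : Finset G.Dart := (Finset.Ico s u).image fun i => (R.next)^[i] d
  let seg : G.Dart → ZMod 2 := fun e => if e ∈ S then 1 else 0
  obtain ⟨φ, hφ⟩ := R.exists_potential euler (fun e => seg e + (p.darts.count e : ZMod 2)) (by
    intro h
    simp only [add_mul, Finset.sum_add_distrib, p.sum_count_darts]
    simp only [seg, ite_mul, one_mul, zero_mul, Finset.sum_ite_mem, Finset.univ_inter, S]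
    rw [Finset.sum_image, R.sum_segment d h (hst.trans htu).le, hx, hy, CharTwo.add_self_eq_zero]
    intro i hi j hj hij
    simp only [Finset.coe_Ico, Set.mem_Ico] at hi hj
    exact hinj (Set.mem_Iio.2 (by omega)) (Set.mem_Iio.2 (by omega)) hij)
  -- Geometrically, push the facial segment into the interior of the face; `ψ` then records the side
  -- of the resulting closed curve on which a dart's flank lies. It can change only at `p`.
  let ψ : G.Dart → ZMod 2 := fun e => φ (R.walkOf e) + seg e
  have hsymm : ∀ e : G.Dart, e.fst ∉ p.support → ψ e.symm = ψ e := by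
    intro e he
    have h := hφ e
    rw [(p.count_darts_eq_zero he).1, (p.count_darts_eq_zero he).2, Nat.cast_zero, add_zero,
      add_zero] at h
    refine (CharTwo.add_eq_zero.1 ?_).symm
    calc ψ e + ψ e.symm
        = (φ (R.walkOf e) + φ (R.walkOf e.symm)) + (seg e + seg e.symm) := by
          simp only [ψ]; ring
      _ = 0 := by rw [h, CharTwo.add_self_eq_zero]
  have hnext : ∀ e : G.Dart, (R.next e).fst ∉ p.support → ψ (R.next e) = ψ e := by
    intro e he
    simp only [ψ, walkOf_next, seg]
    congr 2
    -- Passing from a dart to its successor enters or leaves the segment only at `x` or `y`, and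
    -- both lie on `p`.
    refine propext ⟨fun h => ?_, fun h => ?_⟩
    · obtain ⟨i, hi, hie⟩ := Finset.mem_image.1 h
      rw [Finset.mem_Ico] at hi
      obtain ⟨i, rfl⟩ : ∃ k, i = k + 1 := by
        refine ⟨i - 1, ?_⟩
        rcases i with - | i
        · obtain rfl : s = 0 := by omega
          exact (he (by rw [← hie, hx]; exact p.start_mem_support)).elim
        · rfl
      have hsi : s ≠ i + 1 := by
        rintro rfl
        exact he (by rw [← hie, hx]; exact p.start_mem_support)
      rw [Function.iterate_succ_apply'] at hie
      exact Finset.mem_image.2 ⟨i, Finset.mem_Ico.2 (by omega), R.next.injective hie⟩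
    · obtain ⟨i, hi, rfl⟩ := Finset.mem_image.1 h
      rw [Finset.mem_Ico] at hi
      rw [← Function.iterate_succ_apply' R.next] at he ⊢
      have hiu : i + 1 ≠ u := by
        rintro rfl
        exact he (by rw [hy]; exact p.end_mem_support)
      exact Finset.mem_image.2 ⟨i + 1, Finset.mem_Ico.2 (by omega), rfl⟩
  have hrot : ∀ e : G.Dart, e.fst ∉ p.support → ψ (R.rot e) = ψ e := by
    intro e he
    rw [← R.next_symm, hnext _ (by rw [next_fst]; exact he), hsymm e he]
  have hreach : ∀ a b (q : G.Walk a b), (∀ z ∈ q.support, z ∉ p.support) →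
      ∀ e e' : G.Dart, e.fst = a → e'.fst = b → ψ e = ψ e' := by
    intro a b q
    induction q with
    | @nil a =>
      intro ha e e' he he'
      exact R.eq_of_rot_eq ψ (fun e h => hrot e (h ▸ ha a (by simp))) he he'
    | @cons a b c h q ih =>
      intro ha e e' he he'
      have ha' := ha a (by simp)
      let z : G.Dart := ⟨(a, b), h⟩
      have h1 : ψ e = ψ z := R.eq_of_rot_eq ψ (fun e h => hrot e (h ▸ ha')) he rfl
      rw [h1, ← hsymm z ha']
      exact ih (fun y hy => ha y (by simp [hy])) _ _ rfl he'
  have h := hreach _ _ q hdisj _ _ hx' hy'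
  -- The darts at steps `t` and `v` share a facial walk, so `φ` agrees on them, but only the first
  -- lies in the segment; `ψ` therefore differs.
  have h1 : (R.next)^[t] d ∈ S :=
    Finset.mem_image.2 ⟨t, Finset.mem_Ico.2 ⟨hst.le, htu⟩, rfl⟩
  have h2 : (R.next)^[v] d ∉ S := by
    intro h2
    obtain ⟨i, hi, hiv⟩ := Finset.mem_image.1 h2
    rw [Finset.mem_Ico] at hi
    have := hinj (Set.mem_Iio.2 (by omega)) (Set.mem_Iio.2 hv) hiv
    omega
  simp only [ψ, walkOf_iterate, seg, if_pos h1, if_neg h2, add_zero] at h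
  exact one_ne_zero (left_eq_add.1 h.symm)

end RotationSystem

namespace PlaneEmbedding

variable {V : Type u} {G : SimpleGraph V} (P : PlaneEmbedding.{u, v} G)

theorem walkOf_eq_of_reachable {d d' : G.Dart} (h : G.Reachable d.fst d'.fst)
    (hf : P.faceOf d = P.faceOf d') : P.walkOf d = P.walkOf d' :=
  Sum.inl_injective (P.face_inj _ _ (SimpleGraph.ConnectedComponent.sound h) hf)

/-- Paths in a plane graph that join crossing pairs of vertices of a face have a common vertex. -/
theorem OrderedOn.exists_mem_support [Fintype V] {f : P.Face} {ι : Type*} [LinearOrder ι]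
    {x : ι → V} (hx : P.OrderedOn f x) {s t u v : ι} (hst : s < t) (htu : t < u) (huv : u < v)
    (hadj : G.Reachable (x s) (x t)) (p : G.Walk (x s) (x u)) (q : G.Walk (x t) (x v)) :
    ∃ z ∈ q.support, z ∈ p.support := by
  obtain ⟨c, hc, hcf, hpos, -⟩ := hx
  obtain ⟨d, pos, hmono, hd⟩ := hpos (P.walkOf (c s))
  -- A face may have several boundary walks, but only one in each component of the graph.
  have hwalk : ∀ i, G.Reachable (x s) (x i) → P.walkOf (c i) = P.walkOf (c s) := by
    intro i hi
    refine P.walkOf_eq_of_reachable ?_ ((hcf i).trans (hcf s).symm)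
    rw [hc, hc]
    exact hi.symm
  have hs := hwalk s (SimpleGraph.Reachable.refl _)
  have ht := hwalk t hadj
  have hu := hwalk u p.reachable
  have hv := hwalk v (hadj.trans q.reachable)
  exact P.toRotationSystem.exists_mem_support_of_crossing P.euler d
    (hmono hs ht hst) (hmono ht hu htu) (hmono hu hv huv) (hd v hv).1 p
    (by rw [(hd s hs).2, hc]) (by rw [(hd u hu).2, hc]) q
    (by rw [(hd t ht).2, hc]) (by rw [(hd v hv).2, hc])

/-- Two edges of a face cannot be joined in the wrong way by two disjoint paths. -/
theorem InCyclicOrder.exists_mem_support [Fintype V] {f : P.Face} {k : ℕ} {a b : Fin k → V}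
    (h : P.InCyclicOrder f (interleave a b)) (hedge : ∀ i, s(a i, b i) ∈ G.edgeSet)
    {i l : Fin k} (hil : i ≠ l) (p : G.Walk (a i) (a l)) (q : G.Walk (b i) (b l)) :
    ∃ z ∈ q.support, z ∈ p.support := by
  wlog hlt : i < l generalizing i l
  · simpa using this hil.symm p.reverse q.reverse (lt_of_le_of_ne (not_lt.1 hlt) hil.symm)
  have hab : ∀ i, G.Reachable (a i) (b i) := fun i => SimpleGraph.Adj.reachable (hedge i)
  have l1 : ∀ m : Fin k, (toLex (m, 0) : Fin k ×ₗ Fin 2) < toLex (m, 1) := fun m =>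
    Prod.Lex.toLex_lt_toLex.2 (Or.inr ⟨rfl, by simp⟩)
  have l2 : (toLex (i, 1) : Fin k ×ₗ Fin 2) < toLex (l, 0) :=
    Prod.Lex.toLex_lt_toLex.2 (Or.inl hlt)
  rcases h with h | h
  · exact OrderedOn.exists_mem_support P h (l1 i) l2 (l1 l) (hab i) p q
  -- In the reversed order the vertices are met as b_l, a_l, b_i, a_i, so `p` and `q` change roles.
  · obtain ⟨z, hz, hz'⟩ := OrderedOn.exists_mem_support P h
      (OrderDual.toDual_lt_toDual.2 (l1 l)) (OrderDual.toDual_lt_toDual.2 l2)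
      (OrderDual.toDual_lt_toDual.2 (l1 i)) (hab l).symm q.reverse p.reverse
    have hq : z ∈ q.reverse.support := hz'
    have hp : z ∈ p.reverse.support := hz
    exact ⟨z, by simpa using hq, by simpa using hp⟩

end PlaneEmbedding

/-! ### Degrees in a superposition of two edge sets. -/

/-- The number of edges of `M` at the vertex `v`. -/
def incCount {V : Type*} [DecidableEq V] (M : Finset (Sym2 V)) (v : V) : ℕ :=
  (M.filter (v ∈ ·)).card

theorem finite_neighborSet_fromEdgeSet {V : Type*} (M : Finset (Sym2 V)) (v : V) :
    ((SimpleGraph.fromEdgeSet (M : Set (Sym2 V))).neighborSet v).Finite := by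
  refine Set.Finite.of_injOn (f := fun u => s(v, u)) (t := (M : Set (Sym2 V))) ?_ ?_
    (Finset.finite_toSet _)
  · intro u hu
    exact ((SimpleGraph.fromEdgeSet_adj _).1 hu).1
  · intro x _ y _ h
    exact Sym2.congr_right.1 h

section incCount

variable {V : Type*} [DecidableEq V]

/-- Handshake argument: each edge has both of its ends in `D` or neither. -/
theorem even_sum_incCount {M : Finset (Sym2 V)} {D : Finset V} (hM : ∀ e ∈ M, ¬ e.IsDiag)
    (hD : ∀ x y, s(x, y) ∈ M → x ∈ D → y ∈ D) : Even (∑ v ∈ D, incCount M v) := by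
  simp only [incCount, Finset.card_filter]
  rw [Finset.sum_comm]
  refine Finset.even_sum _ fun e he => ?_
  rw [← Finset.card_filter]
  induction e using Sym2.inductionOn with
  | hf x y =>
    have hne : x ≠ y := fun h => hM _ he (Sym2.mk_isDiag_iff.2 h)
    by_cases hx : x ∈ D
    · have hy := hD x y he hx
      have : D.filter (· ∈ s(x, y)) = {x, y} := by
        ext v
        simp only [Finset.mem_filter, Sym2.mem_iff, Finset.mem_insert, Finset.mem_singleton]
        constructor
        · exact fun h => h.2
        · rintro (rfl | rfl) <;> simp [*]
      rw [this, Finset.card_pair hne]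
      exact even_two
    · have hy : y ∉ D := fun hy => hx (hD y x (Sym2.eq_swap ▸ he) hy)
      have : D.filter (· ∈ s(x, y)) = ∅ := by
        ext v
        simp only [Finset.mem_filter, Sym2.mem_iff, Finset.notMem_empty, iff_false, not_and]
        rintro hv (rfl | rfl) <;> contradiction
      rw [this, Finset.card_empty]
      exact Even.zero

theorem mem_vertsAt_of_mem {k : ℕ} (a : Fin k → V) {I : Finset (Fin k)} {i : Fin k} (hi : i ∈ I) :
    a i ∈ vertsAt a I :=
  Finset.mem_image_of_mem _ hi

theorem incCount_edgesAt {k : ℕ} {a b : Fin k → V} (ha : a.Injective) (hb : b.Injective)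
    (hab : ∀ i l, a i ≠ b l) (I : Finset (Fin k)) (v : V) :
    incCount (edgesAt a b I) v = if v ∈ vertsAt a I ∪ vertsAt b I then 1 else 0 := by
  have hmem : ∀ e, e ∈ (edgesAt a b I).filter (v ∈ ·) ↔
      ∃ i ∈ I, (v = a i ∨ v = b i) ∧ s(a i, b i) = e := by
    intro e
    simp only [edgesAt, Finset.mem_filter, Finset.mem_image]
    constructor
    · rintro ⟨⟨i, hi, rfl⟩, h⟩
      exact ⟨i, hi, Sym2.mem_iff.1 h, rfl⟩
    · rintro ⟨i, hi, h, rfl⟩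
      exact ⟨⟨i, hi, rfl⟩, Sym2.mem_iff.2 h⟩
  rw [incCount]
  split_ifs with h
  · obtain ⟨i, hi, hv⟩ : ∃ i ∈ I, v = a i ∨ v = b i := by
      simp only [vertsAt, Finset.mem_union, Finset.mem_image] at h
      rcases h with ⟨i, hi, rfl⟩ | ⟨i, hi, rfl⟩
      exacts [⟨i, hi, Or.inl rfl⟩, ⟨i, hi, Or.inr rfl⟩]
    refine Finset.card_eq_one.2 ⟨s(a i, b i), ?_⟩
    ext e
    rw [hmem, Finset.mem_singleton]
    constructor
    · rintro ⟨l, -, hl, rfl⟩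
      have : l = i := by
        rcases hv with rfl | rfl <;> rcases hl with hl | hl
        · exact ha hl.symm
        · exact (hab _ _ hl).elim
        · exact (hab _ _ hl.symm).elim
        · exact hb hl.symm
      rw [this]
    · rintro rfl
      exact ⟨i, hi, hv, rfl⟩
  · refine Finset.card_eq_zero.2 (Finset.eq_empty_of_forall_notMem fun e he => h ?_)
    obtain ⟨i, hi, rfl | rfl, -⟩ := (hmem e).1 he
    · exact Finset.mem_union_left _ (Finset.mem_image_of_mem _ hi)
    · exact Finset.mem_union_right _ (Finset.mem_image_of_mem _ hi)

theorem ncard_neighborSet_fromEdgeSet_le (M N : Finset (Sym2 V)) (v : V) :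
    ((SimpleGraph.fromEdgeSet ((M ∪ N : Finset (Sym2 V)) : Set (Sym2 V))).neighborSet v).ncard
      ≤ incCount M v + incCount N v := by
  have h1 : ((SimpleGraph.fromEdgeSet ((M ∪ N : Finset (Sym2 V)) : Set (Sym2 V))).neighborSet
      v).ncard ≤ (((M ∪ N).filter (v ∈ ·) : Finset (Sym2 V)) : Set (Sym2 V)).ncard := by
    refine Set.ncard_le_ncard_of_injOn (fun u => s(v, u)) ?_ ?_ (Finset.finite_toSet _)
    · intro u hu
      have := ((SimpleGraph.fromEdgeSet_adj _).1 hu).1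
      simp only [Finset.coe_filter, Set.mem_ofPred_eq]
      exact ⟨this, Sym2.mem_mk_left _ _⟩
    · intro x _ y _ h
      exact Sym2.congr_right.1 h
  rw [Set.ncard_coe_finset, Finset.filter_union] at h1
  exact h1.trans (Finset.card_union_le _ _)

/-- In a union of two edge sets in which all degrees are at most two, a path between two vertices of
degree one is a whole component, and all its inner vertices have degree two. -/
theorem SimpleGraph.Walk.IsPath.closed_of_incCount {M N : Finset (Sym2 V)} {x y : V} (hxy : x ≠ y)
    {p : (SimpleGraph.fromEdgeSet ((M ∪ N : Finset (Sym2 V)) : Set (Sym2 V))).Walk x y}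
    (hp : p.IsPath) (hdeg : ∀ v, incCount M v + incCount N v ≤ 2)
    (hx : incCount M x + incCount N x ≤ 1) (hy : incCount M y + incCount N y ≤ 1)
    {v : V} (hv : v ∈ p.support) :
    (∀ u, s(v, u) ∈ M ∪ N → v ≠ u → u ∈ p.support) ∧
      (v ≠ x → v ≠ y → incCount M v + incCount N v = 2) := by
  have hnil : ¬ p.Nil := fun h => hxy h.eq
  have hsub : p.toSubgraph.neighborSet v ⊆
      (SimpleGraph.fromEdgeSet ((M ∪ N : Finset (Sym2 V)) : Set (Sym2 V))).neighborSet v :=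
    fun u hu => p.toSubgraph.adj_sub hu
  have hfin := finite_neighborSet_fromEdgeSet (M ∪ N) v
  have hle := ncard_neighborSet_fromEdgeSet_le M N v
  have hle' := Set.ncard_le_ncard hsub hfin
  -- The path alone already uses up the permitted degree at `v`, so all inequalities above are
  -- equalities.
  have hmain : incCount M v + incCount N v ≤ (p.toSubgraph.neighborSet v).ncard := by
    obtain ⟨i, rfl, hi⟩ := SimpleGraph.Walk.mem_support_iff_exists_getVert.1 hv
    rcases Nat.eq_zero_or_pos i with rfl | hi0
    · rw [SimpleGraph.Walk.getVert_zero, hp.neighborSet_toSubgraph_startpoint hnil]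
      simpa using hx
    · rcases hi.lt_or_eq with hi | rfl
      · rw [hp.ncard_neighborSet_toSubgraph_internal_eq_two hi0.ne' hi]
        exact hdeg _
      · rw [SimpleGraph.Walk.getVert_length, hp.neighborSet_toSubgraph_endpoint hnil]
        simpa using hy
  refine ⟨fun u hu hvu => ?_, fun hvx hvy => ?_⟩
  · have heq := Set.eq_of_subset_of_ncard_le hsub (hle.trans hmain) hfin
    have hu' : u ∈ p.toSubgraph.neighborSet v := by
      rw [heq]
      exact (SimpleGraph.fromEdgeSet_adj _).2 ⟨hu, hvu⟩
    exact p.mem_verts_toSubgraph.1 (p.toSubgraph.edge_vert hu'.symm)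
  · refine le_antisymm (hdeg v) ?_
    obtain ⟨i, rfl, hi⟩ := SimpleGraph.Walk.mem_support_iff_exists_getVert.1 hv
    have hi0 : i ≠ 0 := by
      rintro rfl
      exact hvx p.getVert_zero
    have hil : i ≠ p.length := by
      rintro rfl
      exact hvy p.getVert_length
    rw [← hp.ncard_neighborSet_toSubgraph_internal_eq_two hi0 (lt_of_le_of_ne hi hil)]
    exact hle'.trans hle

/-- A path from `a j` to `a l` would be a whole component of the superposition. Off it, the
superposition enlarged by the marked edges of `T` connects `b j` to `b l`, as otherwise the
component of `b j` would have a single vertex of odd degree. The two disjoint walks contradict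
`hcross`. -/
theorem not_reachable_of_incCount [Fintype V] {G : SimpleGraph V} {k : ℕ} {a b : Fin k → V}
    (hcross : ∀ i l, i ≠ l → ∀ (p : G.Walk (a i) (a l)) (q : G.Walk (b i) (b l)),
      ∃ z ∈ q.support, z ∈ p.support)
    (hedge : ∀ i, s(a i, b i) ∈ G.edgeSet)
    (ha : a.Injective) (hb : b.Injective) (hab : ∀ i l, a i ≠ b l)
    {M N : Finset (Sym2 V)} (hM : ∀ e ∈ M, e ∈ G.edgeSet) (hN : ∀ e ∈ N, e ∈ G.edgeSet)
    {T : Finset (Fin k)}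
    (hdeg : ∀ v, incCount M v + incCount N v = if v ∈ vertsAt a T ∪ vertsAt b T then 1 else 2)
    {j l : Fin k} (hj : j ∈ T) (hl : l ∈ T) (hjl : j ≠ l) :
    ¬ (SimpleGraph.fromEdgeSet ((M ∪ N : Finset (Sym2 V)) : Set (Sym2 V))).Reachable
      (a j) (a l) := by
  classical
  intro hr
  obtain ⟨p, hp⟩ := hr.exists_isPath
  have hodda : ∀ i ∈ T, incCount M (a i) + incCount N (a i) = 1 := fun i hi => by
    rw [hdeg, if_pos (Finset.mem_union_left _ (mem_vertsAt_of_mem a hi))]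
  have hoddb : ∀ i ∈ T, incCount M (b i) + incCount N (b i) = 1 := fun i hi => by
    rw [hdeg, if_pos (Finset.mem_union_right _ (mem_vertsAt_of_mem b hi))]
  have hclosed := fun v (hv : v ∈ p.support) => hp.closed_of_incCount (ha.ne hjl)
    (fun v => by rw [hdeg]; split_ifs <;> omega) (hodda j hj).le (hodda l hl).le hv
  have hbO : ∀ i ∈ T, b i ∉ p.support := fun i hi hv => by
    have := (hclosed _ hv).2 (hab _ _).symm (hab _ _).symm
    rw [hoddb i hi] at this
    omega
  have haO : ∀ i ∈ T, i ≠ j → i ≠ l → a i ∉ p.support := fun i hi hij hil hv => by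
    have := (hclosed _ hv).2 (ha.ne hij) (ha.ne hil)
    rw [hodda i hi] at this
    omega
  let K : SimpleGraph V :=
    { Adj := fun x y => s(x, y) ∈ M ∪ N ∪ edgesAt a b T ∧ x ≠ y ∧ x ∉ p.support ∧ y ∉ p.support
      symm := ⟨fun x y h => ⟨by rw [Sym2.eq_swap]; exact h.1, h.2.1.symm, h.2.2.2, h.2.2.1⟩⟩
      loopless := ⟨fun x h => h.2.1 rfl⟩ }
  have hE : ∀ e ∈ edgesAt a b T, e ∈ G.edgeSet := by
    intro e he
    obtain ⟨i, -, rfl⟩ := Finset.mem_image.1 he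
    exact hedge i
  have hKG : K ≤ G := by
    intro x y h
    rcases Finset.mem_union.1 h.1 with h | h
    · rcases Finset.mem_union.1 h with h | h
      exacts [hM _ h, hN _ h]
    · exact hE _ h
  have hHG : SimpleGraph.fromEdgeSet ((M ∪ N : Finset (Sym2 V)) : Set (Sym2 V)) ≤ G := by
    intro x y h
    rcases Finset.mem_union.1 ((SimpleGraph.fromEdgeSet_adj _).1 h).1 with h | h
    exacts [hM _ h, hN _ h]
  have hKO : ∀ x y, K.Reachable x y → x ∉ p.support → y ∉ p.support := by
    rintro x y ⟨q⟩
    induction q with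
    | nil => exact id
    | cons h q ih => exact fun _ => ih h.2.2.2
  by_cases hreach : K.Reachable (b j) (b l)
  · obtain ⟨q⟩ := hreach
    obtain ⟨z, hzq, hzp⟩ := hcross j l hjl (p.mapLe hHG) (q.mapLe hKG)
    rw [SimpleGraph.Walk.support_mapLe_eq_support] at hzq hzp
    exact hKO _ _ (q.takeUntil z hzq).reachable (hbO j hj) hzp
  · let D : Finset V := Finset.univ.filter (K.Reachable (b j))
    have hD : ∀ v, v ∈ D ↔ K.Reachable (b j) v := fun v => by simp [D]
    have hDO : ∀ v ∈ D, v ∉ p.support := fun v hv => hKO _ _ ((hD v).1 hv) (hbO j hj)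
    have hstep : ∀ x y, s(x, y) ∈ M ∪ N ∪ edgesAt a b T → x ∈ D → y ∉ p.support → y ∈ D := by
      intro x y h hx hy
      by_cases hxy : x = y
      · exact hxy ▸ hx
      · exact (hD y).2 (((hD x).1 hx).trans
          (SimpleGraph.Adj.reachable (G := K) ⟨h, hxy, hDO x hx, hy⟩))
    have hMN : ∀ x y, s(x, y) ∈ M ∪ N → x ∈ D → y ∈ D := by
      intro x y h hx
      refine hstep x y (Finset.mem_union_left _ h) hx fun hy => ?_
      by_cases hxy : y = x
      · exact hDO x hx (hxy ▸ hy)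
      · exact hDO x hx ((hclosed y hy).1 x (Sym2.eq_swap ▸ h) hxy)
    -- The marked edges at `j` and `l` have an end on `p`; the remaining ones of `T` avoid `p`
    -- altogether.
    let T' := (T.erase j).erase l
    have hT' : ∀ i, i ∈ T' ↔ i ≠ l ∧ i ≠ j ∧ i ∈ T := fun i => by simp [T']
    have hE' : ∀ x y, s(x, y) ∈ edgesAt a b T' → x ∈ D → y ∈ D := by
      intro x y h hx
      obtain ⟨i, hi, hixy⟩ := Finset.mem_image.1 h
      obtain ⟨hil, hij, hi⟩ := (hT' i).1 hi
      refine hstep x y ?_ hx ?_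
      · rw [← hixy]
        exact Finset.mem_union_right _ (Finset.mem_image_of_mem _ hi)
      · rcases Sym2.eq_iff.1 hixy with ⟨-, rfl⟩ | ⟨rfl, -⟩
        exacts [hbO i hi, haO i hi hij hil]
    have hdiag : ∀ e ∈ G.edgeSet, ¬ e.IsDiag := fun e he => G.not_isDiag_of_mem_edgeSet he
    have hev : Even (∑ v ∈ D, (incCount M v + incCount N v + incCount (edgesAt a b T') v)) := by
      rw [Finset.sum_add_distrib, Finset.sum_add_distrib]
      refine ((even_sum_incCount (fun e he => hdiag e (hM e he)) ?_).add
        (even_sum_incCount (fun e he => hdiag e (hN e he)) ?_)).add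
        (even_sum_incCount ?_ hE')
      · exact fun x y h => hMN x y (Finset.mem_union_left _ h)
      · exact fun x y h => hMN x y (Finset.mem_union_right _ h)
      · intro e he
        obtain ⟨i, -, rfl⟩ := Finset.mem_image.1 he
        exact hdiag _ (hedge i)
    have hbj : b j ∈ D := (hD _).2 (SimpleGraph.Reachable.refl _)
    -- The marked edges raise degree one to two everywhere in `D` except at `b j`, the exceptions `a
    -- j`, `a l`, `b l` being outside `D`.
    have hval : ∀ v ∈ D, incCount M v + incCount N v + incCount (edgesAt a b T') v
        = if v = b j then 1 else 2 := by
      intro v hv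
      have hvj : v ≠ a j := fun h => hDO v hv (h ▸ p.start_mem_support)
      have hvl : v ≠ a l := fun h => hDO v hv (h ▸ p.end_mem_support)
      have hvbl : v ≠ b l := fun h => hreach ((hD _).1 (h ▸ hv))
      rw [hdeg, incCount_edgesAt ha hb hab]
      by_cases hvT : v ∈ vertsAt a T ∪ vertsAt b T
      · rw [if_pos hvT]
        by_cases hvb : v = b j
        · rw [if_pos hvb, if_neg]
          simp only [vertsAt, Finset.mem_union, Finset.mem_image]
          rintro (⟨i, hi, rfl⟩ | ⟨i, hi, rfl⟩)
          · exact hab _ _ hvb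
          · exact ((hT' i).1 hi).2.1 (hb hvb)
        · rw [if_neg hvb, if_pos]
          simp only [vertsAt, Finset.mem_union, Finset.mem_image] at hvT ⊢
          rcases hvT with ⟨i, hi, rfl⟩ | ⟨i, hi, rfl⟩
          · exact Or.inl ⟨i, (hT' i).2 ⟨fun h => hvl (h ▸ rfl), fun h => hvj (h ▸ rfl), hi⟩, rfl⟩
          · exact Or.inr ⟨i, (hT' i).2 ⟨fun h => hvbl (h ▸ rfl), fun h => hvb (h ▸ rfl), hi⟩, rfl⟩
      · have hvb : v ≠ b j := by
          rintro rfl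
          exact hvT (Finset.mem_union_right _ (Finset.mem_image_of_mem _ hj))
        rw [if_neg hvT, if_neg hvb, if_neg]
        intro h
        refine hvT ?_
        simp only [vertsAt, Finset.mem_union, Finset.mem_image] at h ⊢
        rcases h with ⟨i, hi, rfl⟩ | ⟨i, hi, rfl⟩
        exacts [Or.inl ⟨i, ((hT' i).1 hi).2.2, rfl⟩, Or.inr ⟨i, ((hT' i).1 hi).2.2, rfl⟩]
    rw [Finset.sum_congr rfl hval, ← Finset.add_sum_erase _ _ hbj, if_pos rfl] at hev
    have hev' : Even (∑ v ∈ D.erase (b j), if v = b j then 1 else 2) := by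
      refine Finset.even_sum _ fun v hv => ?_
      rw [if_neg (Finset.ne_of_mem_erase hv)]
      exact even_two
    rw [Nat.even_add] at hev
    exact Nat.not_even_one (hev.2 hev')

end incCount

/-! ### Exchanging two edge sets on a component. -/

section swap

variable {V : Type*} [DecidableEq V]

open Classical in
/-- Replace the edges of `M` that meet the vertex set `O` by those of `N`. -/
noncomputable def swapOn (O : Set V) (M N : Finset (Sym2 V)) : Finset (Sym2 V) :=
  M.filter (fun e => ¬ ∃ v ∈ e, v ∈ O) ∪ N.filter (fun e => ∃ v ∈ e, v ∈ O)

theorem mem_swapOn {O : Set V} {M N : Finset (Sym2 V)} {e : Sym2 V} :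
    e ∈ swapOn O M N ↔ (e ∈ M ∧ ¬ ∃ v ∈ e, v ∈ O) ∨ (e ∈ N ∧ ∃ v ∈ e, v ∈ O) := by
  simp only [swapOn, Finset.mem_union, Finset.mem_filter]

theorem swapOn_subset {O : Set V} {M N E : Finset (Sym2 V)} (hM : M ⊆ E) (hN : N ⊆ E) :
    swapOn O M N ⊆ E := by
  intro e he
  rcases mem_swapOn.1 he with h | h
  exacts [hM h.1, hN h.1]

theorem swapOn_union_swapOn (O : Set V) (M N : Finset (Sym2 V)) :
    swapOn O M N ∪ swapOn O N M = M ∪ N := by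
  ext e
  simp only [Finset.mem_union, mem_swapOn]
  tauto

theorem swapOn_swapOn (O : Set V) (M N : Finset (Sym2 V)) :
    swapOn O (swapOn O M N) (swapOn O N M) = M := by
  ext e
  simp only [mem_swapOn]
  by_cases h : ∃ v ∈ e, v ∈ O <;> simp [h]

theorem prod_swapOn_mul_prod_swapOn {R : Type*} [CommMonoid R] (w : Sym2 V → R) (O : Set V)
    (M N : Finset (Sym2 V)) :
    (∏ e ∈ swapOn O M N, w e) * ∏ e ∈ swapOn O N M, w e = (∏ e ∈ M, w e) * ∏ e ∈ N, w e := by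
  classical
  have h : ∀ M N : Finset (Sym2 V), ∏ e ∈ swapOn O M N, w e =
      (∏ e ∈ M.filter (fun e => ¬ ∃ v ∈ e, v ∈ O), w e) *
        ∏ e ∈ N.filter (fun e => ∃ v ∈ e, v ∈ O), w e := by
    intro M N
    rw [swapOn, Finset.prod_union]
    refine Finset.disjoint_left.2 fun e he he' => ?_
    exact (Finset.mem_filter.1 he).2 (Finset.mem_filter.1 he').2
  rw [h, h, ← Finset.prod_filter_mul_prod_filter_not M (fun e => ∃ v ∈ e, v ∈ O),
    ← Finset.prod_filter_mul_prod_filter_not N (fun e => ∃ v ∈ e, v ∈ O)]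
  ac_rfl

theorem incCount_swapOn_of_mem {O : Set V} {M N : Finset (Sym2 V)} {v : V} (hv : v ∈ O) :
    incCount (swapOn O M N) v = incCount N v := by
  rw [incCount, incCount]
  congr 1
  ext e
  simp only [Finset.mem_filter, mem_swapOn]
  constructor
  · rintro ⟨h | h, hve⟩
    exacts [(h.2 ⟨v, hve, hv⟩).elim, ⟨h.1, hve⟩]
  · exact fun h => ⟨Or.inr ⟨h.1, v, h.2, hv⟩, h.2⟩

theorem incCount_swapOn_of_notMem {O : Set V} {M N : Finset (Sym2 V)} {v : V}
    (hO : ∀ e ∈ M ∪ N, ∀ x ∈ e, ∀ y ∈ e, x ∈ O → y ∈ O) (hv : v ∉ O) :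
    incCount (swapOn O M N) v = incCount M v := by
  rw [incCount, incCount]
  congr 1
  ext e
  simp only [Finset.mem_filter, mem_swapOn]
  constructor
  · rintro ⟨h | ⟨h, x, hx, hxO⟩, hve⟩
    exacts [⟨h.1, hve⟩, (hv (hO e (Finset.mem_union_right _ h) x hx v hve hxO)).elim]
  · rintro ⟨h, hve⟩
    refine ⟨Or.inl ⟨h, ?_⟩, hve⟩
    rintro ⟨x, hx, hxO⟩
    exact hv (hO e (Finset.mem_union_left _ h) x hx v hve hxO)

/-- The connected component of a vertex in the graph with edge set `M`. -/
def edgeComponent (M : Finset (Sym2 V)) (x : V) : Set V :=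
  {v | (SimpleGraph.fromEdgeSet (M : Set (Sym2 V))).Reachable x v}

theorem edgeComponent_closed (M : Finset (Sym2 V)) (x : V) :
    ∀ e ∈ M, ∀ y ∈ e, ∀ z ∈ e, y ∈ edgeComponent M x → z ∈ edgeComponent M x := by
  intro e he y hy z hz h
  by_cases hyz : y = z
  · exact hyz ▸ h
  · have : e = s(y, z) := (Sym2.mem_and_mem_iff hyz).1 ⟨hy, hz⟩
    exact SimpleGraph.Reachable.trans h (SimpleGraph.Adj.reachable
      ((SimpleGraph.fromEdgeSet_adj _).2 ⟨this ▸ he, hyz⟩))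

end swap

/-! ### Weighted counts of matchings and the exchange identity. -/

section matchingPoly

variable {V : Type*} [DecidableEq V] {R : Type*} [CommRing R]

/-- `M` is a matching that covers exactly the vertices outside `S`. -/
def MatchesOff (S : Finset V) (M : Finset (Sym2 V)) : Prop :=
  ∀ v, incCount M v = if v ∈ S then 0 else 1

open Classical in
/-- The weighted number of matchings in the edge set `E` that cover exactly the vertices
outside `S`. -/
noncomputable def matchingPoly (w : Sym2 V → R) (E : Finset (Sym2 V)) (S : Finset V) : R :=
  ∑ M ∈ E.powerset with MatchesOff S M, ∏ e ∈ M, w e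

theorem MatchesOff.notMem_of_mem {S : Finset V} {M : Finset (Sym2 V)} (h : MatchesOff S M)
    {e : Sym2 V} (he : e ∈ M) {v : V} (hv : v ∈ e) : v ∉ S := by
  intro hS
  have := h v
  rw [if_pos hS, incCount, Finset.card_eq_zero] at this
  exact Finset.notMem_empty e (this ▸ Finset.mem_filter.2 ⟨he, hv⟩)

theorem matchingPoly_congr_edges (w : Sym2 V → R) {E E' : Finset (Sym2 V)} {S : Finset V}
    (h : ∀ e, (∀ v ∈ e, v ∉ S) → (e ∈ E ↔ e ∈ E')) :
    matchingPoly w E S = matchingPoly w E' S := by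
  classical
  unfold matchingPoly
  congr 1
  ext M
  simp only [Finset.mem_filter, Finset.mem_powerset]
  refine and_congr_left fun hM => ?_
  exact forall₂_congr fun e he => h e fun v hv => hM.notMem_of_mem he hv

theorem matchingPoly_eq_zero [Fintype V] (hV : Even (Fintype.card V)) (w : Sym2 V → R)
    {E : Finset (Sym2 V)} (hE : ∀ e ∈ E, ¬ e.IsDiag) {S : Finset V} (hS : Odd S.card) :
    matchingPoly w E S = 0 := by
  classical
  unfold matchingPoly
  rw [Finset.filter_eq_empty_iff.2, Finset.sum_empty]
  intro M hM hMS
  have h := even_sum_incCount (M := M) (D := Finset.univ)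
    (fun e he => hE e (Finset.mem_powerset.1 hM he)) (fun _ _ _ _ => Finset.mem_univ _)
  rw [Finset.sum_congr rfl fun v _ => hMS v] at h
  have h2 : ∑ v : V, (if v ∈ S then 0 else 1) = Sᶜ.card := by
    rw [show Sᶜ = Finset.univ.filter (· ∉ S) by ext; simp, Finset.card_filter]
    refine Finset.sum_congr rfl fun v _ => ?_
    by_cases hv : v ∈ S <;> simp [hv]
  rw [h2] at h
  have := S.card_add_card_compl
  rw [← this, Nat.even_add] at hV
  exact (Nat.not_even_iff_odd.2 hS) (hV.2 h)

theorem incCount_insert {M : Finset (Sym2 V)} {x y : V} (h : s(x, y) ∉ M) (v : V) :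
    incCount (insert s(x, y) M) v = incCount M v + if v = x ∨ v = y then 1 else 0 := by
  rw [incCount, Finset.filter_insert]
  split_ifs with h1 h2 h2
  · rw [Finset.card_insert_of_notMem fun h' => h (Finset.mem_filter.1 h').1, incCount]
  · exact (h2 (Sym2.mem_iff.1 h1)).elim
  · exact (h1 (Sym2.mem_iff.2 h2)).elim
  · rfl

theorem matchesOff_insert {S : Finset V} {M : Finset (Sym2 V)} {x y : V} (h : s(x, y) ∉ M)
    (hx : x ∉ S) (hy : y ∉ S) :
    MatchesOff S (insert s(x, y) M) ↔ MatchesOff (insert x (insert y S)) M := by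
  refine forall_congr' fun v => ?_
  rw [incCount_insert h]
  simp only [Finset.mem_insert]
  by_cases hvx : v = x
  · subst hvx; simp [hx]
  · by_cases hvy : v = y
    · subst hvy; simp [hy]
    · simp [hvx, hvy]

theorem matchingPoly_insert (w : Sym2 V → R) {E : Finset (Sym2 V)} {S : Finset V} {x y : V}
    (h : s(x, y) ∉ E) (hx : x ∉ S) (hy : y ∉ S) :
    matchingPoly w (insert s(x, y) E) S
      = matchingPoly w E S + w s(x, y) * matchingPoly w E (insert x (insert y S)) := by
  classical
  unfold matchingPoly
  simp only [Finset.sum_filter]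
  rw [Finset.sum_powerset_insert h, Finset.mul_sum]
  congr 1
  refine Finset.sum_congr rfl fun M hM => ?_
  have hM' : s(x, y) ∉ M := fun h' => h (Finset.mem_powerset.1 hM h')
  rw [mul_ite, mul_zero]
  simp only [matchesOff_insert hM' hx hy, Finset.prod_insert hM']

/-- `L` is the set of marked edges that a matching uses; each contributes its weight and removes its
two ends. -/
theorem matchingPoly_union_edgesAt (w : Sym2 V → R) {k : ℕ} {a b : Fin k → V}
    (ha : a.Injective) (hb : b.Injective) (hab : ∀ i l, a i ≠ b l) {E : Finset (Sym2 V)}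
    (hE : ∀ i, s(a i, b i) ∉ E) (X : Finset (Fin k)) (S : Finset V)
    (haS : ∀ i ∈ X, a i ∉ S) (hbS : ∀ i ∈ X, b i ∉ S) :
    matchingPoly w (E ∪ edgesAt a b X) S = ∑ L ∈ X.powerset,
      (∏ i ∈ L, w s(a i, b i)) * matchingPoly w E (S ∪ vertsAt a L ∪ vertsAt b L) := by
  induction X using Finset.induction_on generalizing S with
  | empty => simp [edgesAt, vertsAt]
  | insert i X hi ih =>
    have h1 : E ∪ edgesAt a b (insert i X) = insert s(a i, b i) (E ∪ edgesAt a b X) := by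
      rw [edgesAt, Finset.image_insert, Finset.union_insert, edgesAt]
    have h2 : s(a i, b i) ∉ E ∪ edgesAt a b X := by
      rw [Finset.mem_union, not_or]
      refine ⟨hE i, fun h => ?_⟩
      obtain ⟨l, hl, h⟩ := Finset.mem_image.1 h
      rcases Sym2.eq_iff.1 h with ⟨h, -⟩ | ⟨h, -⟩
      · exact hi (ha h ▸ hl)
      · exact hab _ _ h
    have hX : ∀ l ∈ X, l ≠ i := fun l hl h => hi (h ▸ hl)
    have haS' := fun l hl => haS l (Finset.mem_insert_of_mem hl)
    have hbS' := fun l hl => hbS l (Finset.mem_insert_of_mem hl)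
    rw [h1, matchingPoly_insert w h2 (haS i (Finset.mem_insert_self _ _))
      (hbS i (Finset.mem_insert_self _ _)), Finset.sum_powerset_insert hi, ih S haS' hbS', ih,
      Finset.mul_sum]
    · congr 1
      refine Finset.sum_congr rfl fun L hL => ?_
      have hiL : i ∉ L := fun h => hi (Finset.mem_powerset.1 hL h)
      rw [Finset.prod_insert hiL, mul_assoc]
      congr 3
      simp only [vertsAt, Finset.image_insert]
      ext v
      simp only [Finset.mem_union, Finset.mem_insert]
      tauto
    · intro l hl h
      simp only [Finset.mem_insert] at h
      rcases h with h | h | h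
      exacts [hX l hl (ha h), hab _ _ h, haS' l hl h]
    · intro l hl h
      simp only [Finset.mem_insert] at h
      rcases h with h | h | h
      exacts [hab _ _ h.symm, hX l hl (hb h), hbS' l hl h]

/-- A pair of matchings: on the vertices of `B` exactly one of them is defined, and elsewhere they
miss exactly `S` and `S'`, respectively. -/
def PairMatchesOff (B S S' : Finset V) (p : Finset (Sym2 V) × Finset (Sym2 V)) : Prop :=
  ∀ v, if v ∈ B then incCount p.1 v + incCount p.2 v = 1
    else incCount p.1 v = (if v ∈ S then 0 else 1) ∧ incCount p.2 v = if v ∈ S' then 0 else 1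

-- `K` can be read off from a pair: it consists of the `i ∈ T` for which the second matching misses
-- `b i`. Summing over `K` thus leaves open which matching covers each `b i`.
open Classical in
theorem sum_matchingPoly_mul_matchingPoly (w : Sym2 V → R) {k : ℕ} {b : Fin k → V}
    (hb : b.Injective) (E : Finset (Sym2 V)) (T : Finset (Fin k)) {S S' : Finset V}
    (hS : ∀ i, b i ∉ S) (hS' : ∀ i, b i ∉ S') :
    ∑ K ∈ T.powerset, matchingPoly w E (S ∪ vertsAt b (T \ K)) *
        matchingPoly w E (S' ∪ vertsAt b K)
      = ∑ p ∈ E.powerset ×ˢ E.powerset with PairMatchesOff (vertsAt b T) S S' p,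
        (∏ e ∈ p.1, w e) * ∏ e ∈ p.2, w e := by
  refine Eq.trans ?_ (Finset.sum_fiberwise_of_maps_to (t := T.powerset)
    (g := fun p : Finset (Sym2 V) × Finset (Sym2 V) =>
      T.filter fun i => incCount p.2 (b i) = 0)
    (fun p _ => Finset.mem_powerset.2 (Finset.filter_subset _ _)) _)
  refine Finset.sum_congr rfl fun K hK => ?_
  rw [Finset.mem_powerset] at hK
  rw [matchingPoly, matchingPoly, Finset.sum_mul_sum, ← Finset.sum_product']
  refine Finset.sum_congr ?_ fun _ _ => rfl
  ext ⟨M, N⟩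
  simp only [Finset.mem_product, Finset.mem_filter, Finset.mem_powerset]
  have hmem : ∀ (I : Finset (Fin k)) i, b i ∈ vertsAt b I ↔ i ∈ I := fun I i => by
    rw [vertsAt, hb.mem_finset_image]
  have hsub : ∀ (I : Finset (Fin k)), I ⊆ T → ∀ v ∉ vertsAt b T, v ∉ vertsAt b I :=
    fun I hI v hv h => hv (Finset.image_subset_image hI h)
  constructor
  · rintro ⟨⟨hM, hMS⟩, hN, hNS⟩
    refine ⟨⟨⟨hM, hN⟩, fun v => ?_⟩, ?_⟩
    · by_cases hv : v ∈ vertsAt b T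
      · rw [if_pos hv]
        obtain ⟨i, hi, rfl⟩ := Finset.mem_image.1 hv
        have h1 := hMS (b i)
        have h2 := hNS (b i)
        simp only [Finset.mem_union, hS, hS', hmem, Finset.mem_sdiff, hi, true_and, false_or]
          at h1 h2
        rw [h1, h2]
        by_cases hiK : i ∈ K <;> simp [hiK]
      · rw [if_neg hv]
        have h1 := hMS v
        have h2 := hNS v
        simp only [Finset.mem_union, hsub _ hK v hv, hsub _ Finset.sdiff_subset v hv, or_false]
          at h1 h2
        exact ⟨h1, h2⟩
    · ext i
      have h2 := hNS (b i)
      simp only [Finset.mem_union, hS', hmem, false_or] at h2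
      rw [Finset.mem_filter, h2]
      by_cases hiK : i ∈ K
      · simp [hiK, hK hiK]
      · simp [hiK]
  · rintro ⟨⟨⟨hM, hN⟩, hp⟩, rfl⟩
    refine ⟨⟨hM, fun v => ?_⟩, hN, fun v => ?_⟩
    all_goals
      have h := hp v
      by_cases hv : v ∈ vertsAt b T
      · rw [if_pos hv] at h
        obtain ⟨i, hi, rfl⟩ := Finset.mem_image.1 hv
        simp only [Finset.mem_union, hS, hS', hmem, Finset.mem_sdiff, Finset.mem_filter, hi,
          true_and, false_or]
        dsimp only at h
        split_ifs <;> omega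
      · rw [if_neg hv] at h
        simp only [Finset.mem_union, hsub _ hK v hv, hsub _ Finset.sdiff_subset v hv, or_false]
        first | exact h.1 | exact h.2

/-- The condition on `B` is symmetric in the two matchings, so it survives the exchange; outside `B`
the missed sets trade places exactly on the component. -/
theorem pairMatchesOff_swapOn {B S₁ S₁' S₂ S₂' : Finset V} {M N : Finset (Sym2 V)} {x : V}
    (h : PairMatchesOff B S₁ S₁' (M, N))
    (hin : ∀ v ∈ edgeComponent (M ∪ N) x, v ∉ B → (v ∈ S₂ ↔ v ∈ S₁') ∧ (v ∈ S₂' ↔ v ∈ S₁))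
    (hout : ∀ v ∉ edgeComponent (M ∪ N) x, v ∉ B → (v ∈ S₂ ↔ v ∈ S₁) ∧ (v ∈ S₂' ↔ v ∈ S₁')) :
    PairMatchesOff B S₂ S₂' (swapOn (edgeComponent (M ∪ N) x) M N,
      swapOn (edgeComponent (M ∪ N) x) N M) := by
  have hO := edgeComponent_closed (M ∪ N) x
  have hO' : ∀ e ∈ N ∪ M, ∀ y ∈ e, ∀ z ∈ e, y ∈ edgeComponent (M ∪ N) x →
      z ∈ edgeComponent (M ∪ N) x := by rwa [Finset.union_comm N M]
  intro v
  have hv := h v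
  by_cases hB : v ∈ B
  · rw [if_pos hB] at hv ⊢
    by_cases hvO : v ∈ edgeComponent (M ∪ N) x
    · rw [incCount_swapOn_of_mem hvO, incCount_swapOn_of_mem hvO, add_comm]
      exact hv
    · rw [incCount_swapOn_of_notMem hO hvO, incCount_swapOn_of_notMem hO' hvO]
      exact hv
  · rw [if_neg hB] at hv ⊢
    by_cases hvO : v ∈ edgeComponent (M ∪ N) x
    · simp only [incCount_swapOn_of_mem hvO, hin v hvO hB]
      exact hv.symm
    · simp only [incCount_swapOn_of_notMem hO hvO, incCount_swapOn_of_notMem hO' hvO,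
        hout v hvO hB]
      exact hv

theorem sum_matchingPoly_swap [Fintype V] (w : Sym2 V → R) {G : SimpleGraph V} {k : ℕ}
    {a b : Fin k → V}
    (hcross : ∀ i l, i ≠ l → ∀ (p : G.Walk (a i) (a l)) (q : G.Walk (b i) (b l)),
      ∃ z ∈ q.support, z ∈ p.support)
    (hedge : ∀ i, s(a i, b i) ∈ G.edgeSet)
    (ha : a.Injective) (hb : b.Injective) (hab : ∀ i l, a i ≠ b l)
    {E : Finset (Sym2 V)} (hE : ∀ e ∈ E, e ∈ G.edgeSet) {T : Finset (Fin k)} {j : Fin k}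
    (hj : j ∈ T) :
    ∑ K ∈ T.powerset, matchingPoly w E (vertsAt a T ∪ vertsAt b (T \ K)) *
        matchingPoly w E (vertsAt b K)
      = ∑ K ∈ T.powerset, matchingPoly w E (vertsAt a (T.erase j) ∪ vertsAt b (T \ K)) *
        matchingPoly w E ({a j} ∪ vertsAt b K) := by
  classical
  have hmem : ∀ (I : Finset (Fin k)) i, a i ∈ vertsAt a I ↔ i ∈ I := fun I i => by
    rw [vertsAt, ha.mem_finset_image]
  have hbmem : ∀ (I : Finset (Fin k)) i, b i ∉ vertsAt a I := by
    intro I i h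
    obtain ⟨l, -, h⟩ := Finset.mem_image.1 h
    exact hab _ _ h
  -- Pairs on either side of the identity have the same total degrees, so one obstruction serves the
  -- exchange and its inverse.
  have hreach : ∀ M ⊆ E, ∀ N ⊆ E,
      (PairMatchesOff (vertsAt b T) (vertsAt a T) ∅ (M, N) ∨
        PairMatchesOff (vertsAt b T) (vertsAt a (T.erase j)) {a j} (M, N)) →
      ∀ l ∈ T, a l ∈ edgeComponent (M ∪ N) (a j) → l = j := by
    intro M hM N hN h l hl hr
    by_contra hlj
    refine not_reachable_of_incCount hcross hedge ha hb hab (fun e he => hE e (hM he))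
      (fun e he => hE e (hN he)) (T := T) (fun v => ?_) hj hl (Ne.symm hlj) hr
    rcases h with h | h
    · have hv := h v
      by_cases hvb : v ∈ vertsAt b T
      · rw [if_pos hvb] at hv
        rw [if_pos (Finset.mem_union_right _ hvb)]
        exact hv
      · rw [if_neg hvb] at hv
        simp only [Finset.mem_union, hvb, or_false]
        simp only [Finset.notMem_empty, if_false] at hv
        rw [hv.1, hv.2]
        split_ifs <;> rfl
    · have hv := h v
      by_cases hvb : v ∈ vertsAt b T
      · rw [if_pos hvb] at hv
        rw [if_pos (Finset.mem_union_right _ hvb)]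
        exact hv
      · rw [if_neg hvb] at hv
        simp only [Finset.mem_union, hvb, or_false]
        rw [hv.1, hv.2]
        by_cases hvT : v ∈ vertsAt a T
        · obtain ⟨i, hi, rfl⟩ := Finset.mem_image.1 hvT
          simp only [hmem, Finset.mem_erase, hi, Finset.mem_singleton, ha.eq_iff]
          by_cases hij : i = j <;> simp [hij]
        · have h1 : v ∉ vertsAt a (T.erase j) := fun h' =>
            hvT (Finset.image_subset_image (Finset.erase_subset _ _) h')
          have h2 : v ∉ ({a j} : Finset V) := by
            rw [Finset.mem_singleton]
            rintro rfl
            exact hvT (mem_vertsAt_of_mem a hj)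
          rw [if_neg h1, if_neg h2, if_neg hvT]
  have h1 := sum_matchingPoly_mul_matchingPoly w hb E T (S := vertsAt a T) (S' := ∅)
    (hbmem T) (fun i => Finset.notMem_empty _)
  simp only [Finset.empty_union] at h1
  rw [h1, sum_matchingPoly_mul_matchingPoly w hb E T (hbmem _)
    (fun i => by rw [Finset.mem_singleton]; exact (hab _ _).symm)]
  have hself : ∀ M : Finset (Sym2 V), a j ∈ edgeComponent M (a j) := fun M =>
    SimpleGraph.Reachable.refl _
  have hcase : ∀ v, v ∈ vertsAt a T ↔ v = a j ∨ v ∈ vertsAt a (T.erase j) := by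
    intro v
    conv_lhs => rw [← Finset.insert_erase hj]
    rw [vertsAt, Finset.image_insert, Finset.mem_insert, vertsAt]
  have hnot : a j ∉ vertsAt a (T.erase j) := by simp [hmem]
  have hcomp : ∀ M ⊆ E, ∀ N ⊆ E,
      (PairMatchesOff (vertsAt b T) (vertsAt a T) ∅ (M, N) ∨
        PairMatchesOff (vertsAt b T) (vertsAt a (T.erase j)) {a j} (M, N)) →
      ∀ v ∈ edgeComponent (M ∪ N) (a j), v ∉ vertsAt a (T.erase j) := by
    intro M hM N hN h v hv hva
    obtain ⟨i, hi, rfl⟩ := Finset.mem_image.1 hva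
    exact (Finset.mem_erase.1 hi).1 (hreach M hM N hN h i (Finset.mem_of_mem_erase hi) hv)
  let σ : Finset (Sym2 V) × Finset (Sym2 V) → Finset (Sym2 V) × Finset (Sym2 V) := fun p =>
    (swapOn (edgeComponent (p.1 ∪ p.2) (a j)) p.1 p.2,
      swapOn (edgeComponent (p.1 ∪ p.2) (a j)) p.2 p.1)
  -- The exchange preserves the union, hence also the component on which it acts.
  have hσσ : ∀ p, σ (σ p) = p := fun p => by
    simp only [σ, swapOn_union_swapOn, swapOn_swapOn]
  refine Finset.sum_nbij' σ σ ?_ ?_ (fun p _ => hσσ p) (fun p _ => hσσ p)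
    (fun p _ => (prod_swapOn_mul_prod_swapOn w _ _ _).symm)
  · rintro ⟨M, N⟩ hp
    simp only [Finset.mem_filter, Finset.mem_product, Finset.mem_powerset] at hp ⊢
    refine ⟨⟨swapOn_subset hp.1.1 hp.1.2, swapOn_subset hp.1.2 hp.1.1⟩,
      pairMatchesOff_swapOn hp.2 (fun v hv _ => ?_) (fun v hv _ => ?_)⟩
    · have := hcomp M hp.1.1 N hp.1.2 (Or.inl hp.2) v hv
      simp [this, hcase]
    · have : v ≠ a j := fun h => hv (by rw [h]; exact hself _)
      simp [this, hcase]
  · rintro ⟨M, N⟩ hp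
    simp only [Finset.mem_filter, Finset.mem_product, Finset.mem_powerset] at hp ⊢
    refine ⟨⟨swapOn_subset hp.1.1 hp.1.2, swapOn_subset hp.1.2 hp.1.1⟩,
      pairMatchesOff_swapOn hp.2 (fun v hv _ => ?_) (fun v hv _ => ?_)⟩
    · have := hcomp M hp.1.1 N hp.1.2 (Or.inr hp.2) v hv
      simp [this, hcase]
    · have : v ≠ a j := fun h => hv (by rw [h]; exact hself _)
      simp [this, hcase]

end matchingPoly

/-! ### From perfect matchings of subgraphs to edge sets. -/

theorem graphMinus_verts {V : Type*} (G : SimpleGraph V) (E : Finset (Sym2 V)) (S : Finset V) (v : V) :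
    v ∈ (graphMinus G E S).verts ↔ v ∉ S := by
  simp [graphMinus]

theorem graphMinus_adj {V : Type*} (G : SimpleGraph V) (E : Finset (Sym2 V)) (S : Finset V) (x y : V) :
    (graphMinus G E S).Adj x y ↔ G.Adj x y ∧ s(x, y) ∉ E ∧ x ∉ S ∧ y ∉ S := by
  simp [graphMinus]
  tauto

section matchingSum

variable {V : Type*} [DecidableEq V] {R : Type*} [CommRing R]

theorem matchingSum_graphMinus [Fintype V] (w : Sym2 V → R) {G : SimpleGraph V}
    {F : Finset (Sym2 V)} (hF : ∀ e, e ∈ F ↔ e ∈ G.edgeSet) (E : Finset (Sym2 V)) (S : Finset V) :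
    matchingSum w (graphMinus G E S) = matchingPoly w (F \ E) S := by
  classical
  rw [matchingSum, matchingPoly, ← finsum_mem_coe_finset]
  refine finsum_mem_eq_of_bijOn (fun N => (Set.toFinite N.edgeSet).toFinset) ⟨?_, ?_, ?_⟩ ?_
  · rintro N ⟨hle, hverts, hN⟩
    simp only [Finset.coe_filter, Finset.mem_powerset, Set.mem_ofPred_eq]
    refine ⟨fun e he => ?_, fun v => ?_⟩
    · rw [Set.Finite.mem_toFinset] at he
      induction e using Sym2.inductionOn with
      | hf x y =>
        have h := (graphMinus_adj G E S x y).1 (hle.2 (SimpleGraph.Subgraph.mem_edgeSet.1 he))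
        exact Finset.mem_sdiff.2 ⟨(hF _).2 h.1, h.2.1⟩
    · split_ifs with hv
      · refine Finset.card_eq_zero.2 (Finset.eq_empty_of_forall_notMem fun e he => ?_)
        rw [Finset.mem_filter, Set.Finite.mem_toFinset] at he
        have := N.mem_verts_of_mem_edge he.1 he.2
        rw [hverts, graphMinus_verts] at this
        exact this hv
      · have hv' : v ∈ N.verts := by rwa [hverts, graphMinus_verts]
        obtain ⟨u, hu, huniq⟩ := hN hv'
        refine Finset.card_eq_one.2 ⟨s(v, u), ?_⟩
        ext e
        rw [Finset.mem_filter, Set.Finite.mem_toFinset, Finset.mem_singleton]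
        constructor
        · rintro ⟨he, hve⟩
          obtain ⟨y, rfl⟩ := hve
          rw [huniq y (SimpleGraph.Subgraph.mem_edgeSet.1 he)]
        · rintro rfl
          exact ⟨SimpleGraph.Subgraph.mem_edgeSet.2 hu, Sym2.mem_mk_left _ _⟩
  · rintro N ⟨-, hN, -⟩ N' ⟨-, hN', -⟩ h
    have h' : N.edgeSet = N'.edgeSet := by simpa using h
    refine SimpleGraph.Subgraph.ext (hN.trans hN'.symm) ?_
    funext x y
    rw [← SimpleGraph.Subgraph.mem_edgeSet, h', SimpleGraph.Subgraph.mem_edgeSet]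
  · intro M hM
    simp only [Finset.coe_filter, Finset.mem_powerset, Set.mem_ofPred_eq] at hM
    obtain ⟨hM, hMS⟩ := hM
    have hMF : ∀ e ∈ M, e ∈ G.edgeSet ∧ e ∉ E := fun e he =>
      ⟨(hF e).1 (Finset.mem_sdiff.1 (hM he)).1, (Finset.mem_sdiff.1 (hM he)).2⟩
    let N : G.Subgraph :=
      { verts := {v | v ∉ S}
        Adj := fun x y => s(x, y) ∈ M
        adj_sub := fun h => (hMF _ h).1
        edge_vert := fun h => hMS.notMem_of_mem h (Sym2.mem_mk_left _ _)
        symm := ⟨fun x y h => by rw [Sym2.eq_swap]; exact h⟩ }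
    have hNe : ∀ e, e ∈ N.edgeSet ↔ e ∈ M := by
      intro e
      induction e using Sym2.inductionOn with
      | hf x y => exact SimpleGraph.Subgraph.mem_edgeSet
    refine ⟨N, ⟨⟨fun v hv => (graphMinus_verts G E S v).2 hv, fun x y h => ?_⟩, ?_, ?_⟩, ?_⟩
    · exact (graphMinus_adj G E S x y).2 ⟨(hMF _ h).1, (hMF _ h).2,
        hMS.notMem_of_mem h (Sym2.mem_mk_left _ _), hMS.notMem_of_mem h (Sym2.mem_mk_right _ _)⟩
    · ext v
      exact (graphMinus_verts G E S v).symm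
    · intro v hv
      have h := hMS v
      rw [if_neg hv, incCount, Finset.card_eq_one] at h
      obtain ⟨e, he⟩ := h
      have hmem : ∀ e', e' ∈ M ∧ v ∈ e' ↔ e' = e := fun e' => by
        rw [← Finset.mem_singleton, ← he, Finset.mem_filter]
      obtain ⟨heM, u, rfl⟩ := (hmem e).2 rfl
      refine ⟨u, heM, fun y hy => ?_⟩
      exact Sym2.congr_right.1 ((hmem s(v, y)).1 ⟨hy, Sym2.mem_mk_left _ _⟩)
    · ext e
      simp [hNe]
  · intro N _
    exact finprod_mem_eq_finite_toFinset_prod _ _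

/-- Marked edges meeting `S` cannot be used, so only those with both ends outside `S` need to agree.
-/
theorem matchingPoly_sdiff_edgesAt (w : Sym2 V → R) {k : ℕ} {a b : Fin k → V}
    (ha : a.Injective) (hab : ∀ i l, a i ≠ b l) {F : Finset (Sym2 V)}
    (hF : ∀ i, s(a i, b i) ∈ F) {X Y : Finset (Fin k)} {S : Finset V}
    (h : ∀ i, a i ∉ S → b i ∉ S → (i ∉ X ↔ i ∈ Y)) :
    matchingPoly w (F \ edgesAt a b X) S
      = matchingPoly w (F \ edgesAt a b Finset.univ ∪ edgesAt a b Y) S := by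
  refine matchingPoly_congr_edges w fun e he => ?_
  have hinj : ∀ i l, s(a i, b i) = s(a l, b l) → i = l := by
    intro i l h
    rcases Sym2.eq_iff.1 h with ⟨h, -⟩ | ⟨h, -⟩
    exacts [ha h, (hab _ _ h).elim]
  have hmem : ∀ (I : Finset (Fin k)) i, s(a i, b i) ∈ edgesAt a b I ↔ i ∈ I := by
    intro I i
    refine ⟨fun h => ?_, fun h => Finset.mem_image_of_mem _ h⟩
    obtain ⟨l, hl, h⟩ := Finset.mem_image.1 h
    exact hinj _ _ h ▸ hl
  by_cases hi : ∃ i, e = s(a i, b i)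
  · obtain ⟨i, rfl⟩ := hi
    have := h i (he _ (Sym2.mem_mk_left _ _)) (he _ (Sym2.mem_mk_right _ _))
    simp [hmem, hF, this]
  · have hnot : ∀ I, e ∉ edgesAt a b I := by
      intro I h
      obtain ⟨i, -, h⟩ := Finset.mem_image.1 h
      exact hi ⟨i, h.symm⟩
    simp [hnot]

end matchingSum

/-! ### Reindexing and assembly of the identity. -/

/-- Both sides run over disjoint pairs of subsets of `Q`; the right one groups them by their union
`T`. -/
theorem sum_powerset_sum_powerset_sdiff {ι M : Type*} [DecidableEq ι] [AddCommMonoid M]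
    (Q : Finset ι) (φ : Finset ι → Finset ι → M) :
    ∑ K ∈ Q.powerset, ∑ L ∈ (Q \ K).powerset, φ K L
      = ∑ T ∈ Q.powerset, ∑ K ∈ T.powerset, φ K (T \ K) := by
  rw [Finset.sum_sigma', Finset.sum_sigma']
  refine Finset.sum_bij' (fun p _ => ⟨p.1 ∪ p.2, p.1⟩) (fun p _ => ⟨p.2, p.1 \ p.2⟩) ?_ ?_ ?_ ?_ ?_
  · rintro ⟨K, L⟩ h
    simp only [Finset.mem_sigma, Finset.mem_powerset] at h ⊢
    exact ⟨Finset.union_subset h.1 (h.2.trans Finset.sdiff_subset), Finset.subset_union_left⟩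
  · rintro ⟨T, K⟩ h
    simp only [Finset.mem_sigma, Finset.mem_powerset] at h ⊢
    exact ⟨h.2.trans h.1, Finset.sdiff_subset_sdiff h.1 le_rfl⟩
  · rintro ⟨K, L⟩ h
    simp only [Finset.mem_sigma, Finset.mem_powerset] at h
    have : Disjoint K L := (Finset.disjoint_sdiff).mono_right h.2
    simp [Finset.union_sdiff_cancel_left this]
  · rintro ⟨T, K⟩ h
    simp only [Finset.mem_sigma, Finset.mem_powerset] at h
    simp [Finset.union_sdiff_of_subset h.2]
  · rintro ⟨K, L⟩ h
    simp only [Finset.mem_sigma, Finset.mem_powerset] at h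
    have : Disjoint K L := (Finset.disjoint_sdiff).mono_right h.2
    simp [Finset.union_sdiff_cancel_left this]

theorem sum_filter_card_indexSet {V M : Type*} [DecidableEq V] [AddCommMonoid M] {k : ℕ}
    {b : Fin k → V} (hb : b.Injective) (q : ℕ → Prop) [DecidablePred q]
    (f : Finset (Fin k) → M) (hf : ∀ K, ¬ q K.card → f K = 0) :
    ∑ W ∈ (Finset.univ.image b).powerset with q W.card, f (indexSet b W)
      = ∑ K ∈ (Finset.univ : Finset (Fin k)).powerset, f K := by
  have hmem : ∀ (I : Finset (Fin k)) i, b i ∈ vertsAt b I ↔ i ∈ I := fun I i => by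
    rw [vertsAt, hb.mem_finset_image]
  have h1 : ∀ K, indexSet b (vertsAt b K) = K := fun K => by
    ext i
    simp [indexSet, hmem]
  have h2 : ∀ W ⊆ Finset.univ.image b, vertsAt b (indexSet b W) = W := by
    intro W hW
    ext v
    simp only [vertsAt, indexSet, Finset.mem_image, Finset.mem_filter, Finset.mem_univ, true_and]
    constructor
    · rintro ⟨i, hi, rfl⟩
      exact hi
    · intro hv
      obtain ⟨i, -, rfl⟩ := Finset.mem_image.1 (hW hv)
      exact ⟨i, hv, rfl⟩
  have hcard : ∀ K, (vertsAt b K).card = K.card := fun K => Finset.card_image_of_injective _ hb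
  rw [← Finset.sum_filter_of_ne (s := (Finset.univ : Finset (Fin k)).powerset)
    (p := fun K => q K.card) fun K _ hK => by_contra fun h => hK (hf K h)]
  refine Finset.sum_nbij' (indexSet b) (vertsAt b) ?_ ?_ ?_ ?_ ?_
  · intro W hW
    rw [Finset.mem_filter, Finset.mem_powerset] at hW ⊢
    refine ⟨Finset.subset_univ _, ?_⟩
    rw [← hcard, h2 W hW.1]
    exact hW.2
  · intro K hK
    rw [Finset.mem_filter, Finset.mem_powerset] at hK ⊢
    refine ⟨Finset.image_subset_image (Finset.subset_univ _), ?_⟩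
    rw [hcard]
    exact hK.2
  · intro W hW
    rw [Finset.mem_filter, Finset.mem_powerset] at hW
    exact h2 W hW.1
  · exact fun K _ => h1 K
  · exact fun W _ => rfl

theorem theorem3p2 {V : Type*} [Fintype V] [DecidableEq V] {R : Type*} [CommRing R]
    (G : SimpleGraph V) (P : PlaneEmbedding G) (f : P.Face) (w : Sym2 V → R)
    (hV : Even (Fintype.card V))
    {k : ℕ} (hk : 2 ≤ k) (a b : Fin k → V)
    (hedge : ∀ i, s(a i, b i) ∈ G.edgeSet)
    (hindep : Pairwise fun i j => Disjoint ({a i, b i} : Set V) {a j, b j})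
    (hbdry : ∀ i, P.OnBoundary f s(a i, b i))
    (hcyc : P.InCyclicOrder f (interleave a b))
    (j : Fin k) :
    ∑ W ∈ (Finset.univ.image b).powerset with Even W.card,
      (∏ e ∈ edgesAt a b (indexSet b W), w e) *
        (matchingSum w (graphMinus G ∅ (vertsAt a (indexSet b W))) *
          matchingSum w (graphMinus G (edgesAt a b (indexSet b W)ᶜ) (vertsAt b (indexSet b W)))) =
    ∑ Y ∈ (Finset.univ.image b).powerset with Odd Y.card,
      (∏ e ∈ edgesAt a b (symmDiff {j} (indexSet b Y)), w e) *
        (matchingSum w (graphMinus G (edgesAt a b (indexSet b Y ∩ {j}))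
            (vertsAt b ({j} \ indexSet b Y) ∪ vertsAt a (indexSet b Y \ {j}))) *
          matchingSum w (graphMinus G (edgesAt a b ((indexSet b Y)ᶜ ∩ {j}ᶜ))
            (vertsAt b ({j}ᶜ \ (indexSet b Y)ᶜ) ∪ vertsAt a ((indexSet b Y)ᶜ \ {j}ᶜ)))) := by
  classical
  have hab : ∀ i l, a i ≠ b l := by
    intro i l h
    by_cases hil : i = l
    · subst hil
      exact G.ne_of_adj (hedge i) h
    · exact Set.disjoint_left.1 (hindep hil) (Set.mem_insert _ _) (by simp [h])
  have ha : a.Injective := by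
    intro i l h
    by_contra hil
    exact Set.disjoint_left.1 (hindep hil) (Set.mem_insert _ _) (by simp [h])
  have hb : b.Injective := by
    intro i l h
    by_contra hil
    exact Set.disjoint_left.1 (hindep hil) (Set.mem_insert_of_mem _ rfl) (by simp [h])
  have hcross : ∀ i l, i ≠ l → ∀ (p : G.Walk (a i) (a l)) (q : G.Walk (b i) (b l)),
      ∃ z ∈ q.support, z ∈ p.support := fun i l hil p q =>
    PlaneEmbedding.InCyclicOrder.exists_mem_support P hcyc hedge hil p q
  obtain ⟨F, hF⟩ : ∃ F : Finset (Sym2 V), ∀ e, e ∈ F ↔ e ∈ G.edgeSet :=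
    ⟨(Set.toFinite G.edgeSet).toFinset, fun e => Set.Finite.mem_toFinset _⟩
  have hFe : ∀ i, s(a i, b i) ∈ F := fun i => (hF _).2 (hedge i)
  have hFd : ∀ E : Finset (Sym2 V), ∀ e ∈ F \ E, ¬ e.IsDiag := fun E e he =>
    G.not_isDiag_of_mem_edgeSet ((hF e).1 (Finset.mem_sdiff.1 he).1)
  have hma : ∀ (I : Finset (Fin k)) i, a i ∈ vertsAt a I ↔ i ∈ I := fun I i => by
    rw [vertsAt, ha.mem_finset_image]
  have hmb : ∀ (I : Finset (Fin k)) i, b i ∈ vertsAt b I ↔ i ∈ I := fun I i => by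
    rw [vertsAt, hb.mem_finset_image]
  have hmab : ∀ (I : Finset (Fin k)) i, a i ∉ vertsAt b I := fun I i h => by
    obtain ⟨l, -, h⟩ := Finset.mem_image.1 h
    exact hab _ _ h.symm
  have hmba : ∀ (I : Finset (Fin k)) i, b i ∉ vertsAt a I := fun I i h => by
    obtain ⟨l, -, h⟩ := Finset.mem_image.1 h
    exact hab _ _ h
  simp only [matchingSum_graphMinus w hF]
  have hprod : ∀ I : Finset (Fin k), ∏ e ∈ edgesAt a b I, w e = ∏ i ∈ I, w s(a i, b i) := by
    intro I
    refine Finset.prod_image fun i _ l _ h => ?_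
    rcases Sym2.eq_iff.1 h with ⟨h, -⟩ | ⟨h, -⟩
    exacts [ha h, (hab _ _ h).elim]
  simp only [hprod]
  set wt : Finset (Fin k) → R := fun I => ∏ i ∈ I, w s(a i, b i) with hwt
  have hwtu : ∀ K L, Disjoint K L → wt (K ∪ L) = wt K * wt L := fun K L h =>
    Finset.prod_union h
  have hwti : ∀ i K, i ∉ K → wt (insert i K) = w s(a i, b i) * wt K := fun i K h =>
    Finset.prod_insert h
  rw [sum_filter_card_indexSet hb (fun n => Even n) (fun K => wt K *
      (matchingPoly w (F \ ∅) (vertsAt a K) *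
        matchingPoly w (F \ edgesAt a b Kᶜ) (vertsAt b K))),
    sum_filter_card_indexSet hb (fun n => Odd n) (fun J => wt (symmDiff {j} J) *
      (matchingPoly w (F \ edgesAt a b (J ∩ {j})) (vertsAt b ({j} \ J) ∪ vertsAt a (J \ {j})) *
        matchingPoly w (F \ edgesAt a b (Jᶜ ∩ {j}ᶜ))
          (vertsAt b ({j}ᶜ \ Jᶜ) ∪ vertsAt a (Jᶜ \ {j}ᶜ))))]
  rotate_left
  -- For even |J| the second factor misses |J| − 1 vertices if `j ∈ J` and |J| + 1 otherwise, an odd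
  -- number.
  · intro J hJ
    rw [Nat.not_odd_iff_even] at hJ
    rw [matchingPoly_eq_zero hV w (hFd _) (S := vertsAt b ({j}ᶜ \ Jᶜ) ∪ vertsAt a (Jᶜ \ {j}ᶜ)),
      mul_zero, mul_zero]
    rw [Finset.card_union_of_disjoint]
    · rw [vertsAt, vertsAt, Finset.card_image_of_injective _ hb,
        Finset.card_image_of_injective _ ha]
      by_cases hj : j ∈ J
      · have h1 : {j}ᶜ \ Jᶜ = J.erase j := by ext; simp
        have h2 : Jᶜ \ {j}ᶜ = ∅ := by ext; simp; rintro h rfl; exact h hj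
        rw [h1, h2, Finset.card_empty, add_zero]
        rw [← Finset.card_erase_add_one hj] at hJ
        rcases Nat.even_or_odd (J.erase j).card with h | h
        · exact absurd hJ (by rw [Nat.not_even_iff_odd]; exact h.add_one)
        · exact h
      · have h1 : {j}ᶜ \ Jᶜ = J := by ext; simp; rintro h rfl; exact hj h
        have h2 : Jᶜ \ {j}ᶜ = {j} := by ext; simp; rintro rfl; exact hj
        rw [h1, h2, Finset.card_singleton]
        exact hJ.add_one
    · refine Finset.disjoint_left.2 fun v hv hv' => ?_
      obtain ⟨i, -, rfl⟩ := Finset.mem_image.1 hv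
      exact hmba _ _ hv'
  · intro K hK
    rw [Nat.not_even_iff_odd] at hK
    rw [matchingPoly_eq_zero hV w (hFd _) (S := vertsAt b K), mul_zero, mul_zero]
    rwa [vertsAt, Finset.card_image_of_injective _ hb]
  set F₀ := F \ edgesAt a b Finset.univ with hF₀
  have hF₀e : ∀ i, s(a i, b i) ∉ F₀ := fun i h =>
    (Finset.mem_sdiff.1 h).2 (Finset.mem_image_of_mem _ (Finset.mem_univ i))
  let Z : Finset V → R := matchingPoly w F₀
  have hexp : ∀ (X Y : Finset (Fin k)) (S : Finset V),
      (∀ i, a i ∉ S → b i ∉ S → (i ∉ X ↔ i ∈ Y)) → (∀ i ∈ Y, a i ∉ S) → (∀ i ∈ Y, b i ∉ S) →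
      matchingPoly w (F \ edgesAt a b X) S
        = ∑ L ∈ Y.powerset, wt L * Z (S ∪ vertsAt a L ∪ vertsAt b L) := by
    intro X Y S h h1 h2
    rw [matchingPoly_sdiff_edgesAt w ha hab hFe h]
    exact matchingPoly_union_edgesAt w ha hb hab hF₀e Y S h1 h2
  have hexp0 : ∀ (X : Finset (Fin k)) (S : Finset V),
      (∀ i, a i ∉ S → b i ∉ S → i ∈ X) → matchingPoly w (F \ edgesAt a b X) S = Z S := by
    intro X S h
    rw [hexp X ∅ S (fun i h1 h2 => by simp [h i h1 h2]) (by simp) (by simp)]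
    simp [hwt, vertsAt]
  -- The left-hand contribution with `K` = I_W and `L` the marked edges used by the first matching;
  -- the second matching can use none.
  let φ : Finset (Fin k) → Finset (Fin k) → R := fun K L =>
    wt (K ∪ L) * (Z (vertsAt a (K ∪ L) ∪ vertsAt b L) * Z (vertsAt b K))
  let Q := Finset.univ.erase j
  have hQ : insert j Q = Finset.univ := Finset.insert_erase (Finset.mem_univ j)
  have hjQ : j ∉ Q := Finset.notMem_erase _ _
  have hlhs : ∀ K, wt K * (matchingPoly w (F \ ∅) (vertsAt a K) *
        matchingPoly w (F \ edgesAt a b Kᶜ) (vertsAt b K))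
      = ∑ L ∈ (Finset.univ \ K).powerset, φ K L := by
    intro K
    rw [hexp0 Kᶜ (vertsAt b K) (fun i _ h => by rw [hmb] at h; simpa using h),
      show (∅ : Finset (Sym2 V)) = edgesAt a b ∅ by simp [edgesAt],
      hexp ∅ (Finset.univ \ K) (vertsAt a K)
      (fun i h _ => by rw [hma] at h; simpa using h)
      (fun i h => by rw [hma]; exact (Finset.mem_sdiff.1 h).2) (fun i _ => hmba _ _), Finset.sum_mul, Finset.mul_sum]
    refine Finset.sum_congr rfl fun L hL => ?_
    have hd : Disjoint K L := Finset.disjoint_sdiff.mono_right (Finset.mem_powerset.1 hL)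
    simp only [φ, hwtu K L hd]
    rw [show vertsAt a (K ∪ L) = vertsAt a K ∪ vertsAt a L from Finset.image_union _ _]
    ring
  -- Index sets of Y without `j`: only the first matching can use marked edges, and not e_j.
  have hrhs1 : ∀ J ∈ Q.powerset, wt (symmDiff {j} J) *
      (matchingPoly w (F \ edgesAt a b (J ∩ {j})) (vertsAt b ({j} \ J) ∪ vertsAt a (J \ {j})) *
        matchingPoly w (F \ edgesAt a b (Jᶜ ∩ {j}ᶜ))
          (vertsAt b ({j}ᶜ \ Jᶜ) ∪ vertsAt a (Jᶜ \ {j}ᶜ)))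
      = ∑ L ∈ (Q \ J).powerset, wt (insert j (J ∪ L)) *
        (Z (vertsAt a (J ∪ L) ∪ vertsAt b (insert j L)) * Z ({a j} ∪ vertsAt b J)) := by
    intro J hJ
    rw [Finset.mem_powerset] at hJ
    have hj : j ∉ J := fun h => hjQ (hJ h)
    have h1 : {j}ᶜ \ Jᶜ = J := by ext; simp; rintro h rfl; exact hj h
    have h2 : Jᶜ \ {j}ᶜ = {j} := by ext; simp; rintro rfl; exact hj
    have h3 : symmDiff {j} J = insert j J := by
      rw [(Finset.disjoint_singleton_left.2 hj).symmDiff_eq_sup]; rfl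
    have h4 : {j} \ J = {j} := by simpa using hj
    have h5 : J \ {j} = J := by simpa using hj
    have h6 : vertsAt a {j} = {a j} := by simp [vertsAt]
    have h7 : vertsAt b {j} = {b j} := by simp [vertsAt]
    rw [h1, h2, h3, h4, h5, h6, h7, hexp0 _ (vertsAt b J ∪ {a j}),
      hexp _ (Q \ J) ({b j} ∪ vertsAt a J)]
    · rw [Finset.sum_mul, Finset.mul_sum]
      refine Finset.sum_congr rfl fun L hL => ?_
      rw [Finset.mem_powerset] at hL
      have hd : Disjoint J L := Finset.disjoint_sdiff.mono_right hL
      have hjL : j ∉ J ∪ L := by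
        rw [Finset.mem_union, not_or]
        exact ⟨hj, fun h => hjQ (Finset.mem_sdiff.1 (hL h)).1⟩
      rw [hwti _ _ hj, hwti _ _ hjL, hwtu _ _ hd,
        show vertsAt a (J ∪ L) = vertsAt a J ∪ vertsAt a L from Finset.image_union _ _,
        show vertsAt b (insert j L) = insert (b j) (vertsAt b L) from Finset.image_insert _ _ _,
        show {b j} ∪ vertsAt a J ∪ vertsAt a L ∪ vertsAt b L
          = vertsAt a J ∪ vertsAt a L ∪ insert (b j) (vertsAt b L) by
            ext; simp only [Finset.mem_union, Finset.mem_insert, Finset.mem_singleton]; tauto,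
        Finset.union_comm (vertsAt b J)]
      ring
    · intro i hi hi'
      simp only [Finset.mem_union, Finset.mem_singleton, hb.eq_iff, hma, hmba, or_false,
        not_or] at hi hi'
      simp [Q, hi, hi']
    · intro i hi
      simp only [Q, Finset.mem_sdiff, Finset.mem_erase] at hi
      simp [hma, hi.2, hab]
    · intro i hi
      simp only [Q, Finset.mem_sdiff, Finset.mem_erase] at hi
      simp [hmba, hb.eq_iff, hi.1.1]
    · intro i hi hi'
      simp only [Finset.mem_union, Finset.mem_singleton, ha.eq_iff, hmb, hmab, false_or,
        not_or] at hi hi'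
      simp [hi, hi']
  -- Index sets of Y containing `j`: the only marked edge open to the second matching is e_j. Not
  -- using it gives `φ J L`, using it gives the other summand.
  have hrhs2 : ∀ J ∈ Q.powerset, wt (symmDiff {j} (insert j J)) *
      (matchingPoly w (F \ edgesAt a b (insert j J ∩ {j}))
        (vertsAt b ({j} \ insert j J) ∪ vertsAt a (insert j J \ {j})) *
        matchingPoly w (F \ edgesAt a b ((insert j J)ᶜ ∩ {j}ᶜ))
          (vertsAt b ({j}ᶜ \ (insert j J)ᶜ) ∪ vertsAt a ((insert j J)ᶜ \ {j}ᶜ)))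
      = ∑ L ∈ (Q \ J).powerset, (φ J L + wt (insert j (J ∪ L)) *
        (Z (vertsAt a (J ∪ L) ∪ vertsAt b L) * Z ({a j} ∪ vertsAt b (insert j J)))) := by
    intro J hJ
    rw [Finset.mem_powerset] at hJ
    have hj : j ∉ J := fun h => hjQ (hJ h)
    have h1 : {j}ᶜ \ (insert j J)ᶜ = J := by
      ext i
      simp only [Finset.mem_sdiff, Finset.mem_compl, Finset.mem_singleton, Finset.mem_insert,
        not_not]
      constructor
      · rintro ⟨h, h' | h'⟩
        exacts [(h h').elim, h']
      · exact fun h => ⟨fun h' => hj (h' ▸ h), Or.inr h⟩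
    have h2 : (insert j J)ᶜ \ {j}ᶜ = ∅ := by ext; simp
    have h3 : symmDiff {j} (insert j J) = J := by
      ext i; simp only [Finset.mem_symmDiff, Finset.mem_singleton, Finset.mem_insert]
      constructor
      · tauto
      · exact fun h => Or.inr ⟨Or.inr h, fun h' => hj (h' ▸ h)⟩
    have h4 : {j} \ insert j J = ∅ := by ext; simp; tauto
    have h5 : insert j J \ {j} = J := by
      rw [← Finset.erase_eq, Finset.erase_insert hj]
    have h6 : ∀ c : Fin k → V, vertsAt c ∅ = ∅ := fun c => by simp [vertsAt]
    have h7 : insert j J ∩ {j} = {j} := by ext; simp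
    rw [h1, h2, h3, h4, h5, h6, h6, h7, Finset.empty_union, Finset.union_empty,
      hexp _ (Q \ J), hexp _ {j}]
    · have hpow : ({j} : Finset (Fin k)).powerset = {∅, {j}} := rfl
      rw [hpow, Finset.sum_pair (Finset.singleton_ne_empty j).symm, Finset.sum_mul,
        Finset.mul_sum]
      refine Finset.sum_congr rfl fun L hL => ?_
      rw [Finset.mem_powerset] at hL
      have hd : Disjoint J L := Finset.disjoint_sdiff.mono_right hL
      have hjL : j ∉ J ∪ L := by
        rw [Finset.mem_union, not_or]
        exact ⟨hj, fun h => hjQ (Finset.mem_sdiff.1 (hL h)).1⟩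
      have hwt0 : wt ∅ = 1 := Finset.prod_empty
      have hwt1 : wt {j} = w s(a j, b j) := Finset.prod_singleton _ _
      simp only [φ]
      rw [hwti _ _ hjL, hwtu _ _ hd, hwt0, hwt1, h6, h6, Finset.union_empty, Finset.union_empty,
        show vertsAt a (J ∪ L) = vertsAt a J ∪ vertsAt a L from Finset.image_union _ _,
        show vertsAt b J ∪ vertsAt a {j} ∪ vertsAt b {j} = {a j} ∪ vertsAt b (insert j J) by
          ext; simp only [vertsAt, Finset.mem_union, Finset.image_insert, Finset.image_singleton,
            Finset.mem_insert, Finset.mem_singleton]; tauto]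
      ring
    · intro i hi hi'
      rw [hmb] at hi'
      simp [hi']
    · exact fun i _ => hmab _ _
    · intro i hi
      rw [Finset.mem_singleton.1 hi, hmb]
      exact hj
    · intro i hi hi'
      rw [hma] at hi
      simp [Q, hi]
    · intro i hi
      rw [hma]
      exact (Finset.mem_sdiff.1 hi).2
    · exact fun i _ => hmba _ _
  rw [Finset.sum_congr rfl fun K _ => hlhs K, sum_powerset_sum_powerset_sdiff, ← hQ,
    Finset.sum_powerset_insert hjQ, Finset.sum_powerset_insert hjQ,
    Finset.sum_congr rfl hrhs1, Finset.sum_congr rfl hrhs2,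
    sum_powerset_sum_powerset_sdiff Q fun J L => wt (insert j (J ∪ L)) *
        (Z (vertsAt a (J ∪ L) ∪ vertsAt b (insert j L)) * Z ({a j} ∪ vertsAt b J)),
    sum_powerset_sum_powerset_sdiff Q fun J L => φ J L + wt (insert j (J ∪ L)) *
        (Z (vertsAt a (J ∪ L) ∪ vertsAt b L) * Z ({a j} ∪ vertsAt b (insert j J))),
    ← Finset.sum_add_distrib, ← Finset.sum_add_distrib]
  -- For each `T` avoiding `j`, the left terms of `T` and `insert j T` are compared together. The
  -- former are the `φ` terms on the right; the latter need the exchange identity, split by whether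
  -- `j ∈ K`.
  refine Finset.sum_congr rfl fun T hT => ?_
  rw [Finset.mem_powerset] at hT
  have hjT : j ∉ T := fun h => hjQ (hT h)
  have hswap := sum_matchingPoly_swap w hcross hedge ha hb hab (E := F₀)
    (fun e he => (hF e).1 (Finset.mem_sdiff.1 he).1) (T := insert j T)
    (Finset.mem_insert_self j T)
  rw [Finset.erase_insert hjT, Finset.sum_powerset_insert hjT (fun K =>
    matchingPoly w F₀ (vertsAt a T ∪ _) * _)] at hswap
  have hl : ∑ K ∈ (insert j T).powerset, φ K (insert j T \ K) = wt (insert j T) *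
      ∑ K ∈ (insert j T).powerset, matchingPoly w F₀ (vertsAt a (insert j T) ∪
        vertsAt b (insert j T \ K)) * matchingPoly w F₀ (vertsAt b K) := by
    rw [Finset.mul_sum]
    refine Finset.sum_congr rfl fun K hK => ?_
    simp only [φ, Z, Finset.union_sdiff_of_subset (Finset.mem_powerset.1 hK)]
  rw [hl, hswap, mul_add, Finset.mul_sum, Finset.mul_sum, Finset.sum_add_distrib, add_left_comm]
  refine congrArg₂ _ ?_ (congrArg₂ _ rfl ?_)
  · refine Finset.sum_congr rfl fun K hK => ?_
    rw [Finset.mem_powerset] at hK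
    rw [Finset.union_sdiff_of_subset hK,
      Finset.insert_sdiff_of_notMem _ fun h => hjT (hK h)]
  · refine Finset.sum_congr rfl fun K hK => ?_
    rw [Finset.mem_powerset] at hK
    rw [Finset.union_sdiff_of_subset hK, Finset.insert_sdiff_insert,
      Finset.sdiff_insert_of_notMem hjT]
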